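/- **Proposition (Reflection operators as vertex operators).** Let $N$ be a natural number and let $R(k_1,k_2)$, $k_1,k_2\in\mathbb R$, be an $N^2\times N^2$ complex $R$-matrix satisfying the Yang–Baxter equation $R_{12}(k_1,k_2)R_{13}(k_1,k_3)R_{23}(k_2,k_3)=R_{23}(k_2,k_3)R_{13}(k_1,k_3)R_{12}(k_1,k_2)$ and unitarity $R_{12}(k_1,k_2)R_{21}(k_2,k_1)=\mathbb I$. Let $a_i(k),a_i^\dagger(k)$ ($1\le i\le N$) be the generators of the ZF algebra, $$a_1a_2=R_{21}a_2a_1,\qquad a_1^\dagger a_2^\dagger=a_2^\dagger a_1^\dagger R_{21},\qquad a_1a_2^\dagger=a_2^\dagger R_{12}a_1+\delta_{12},$$ where $R_{12}=R_{12}(k_1,k_2)$, $R_{21}=R_{21}(k_2,k_1)$, acting on the Fock space, whose vectors $f$ are sequences of $R$-symmetric correlation functions $\langle\Omega|a_{i_n}(k_n)\cdots a_{i_1}(k_1)|f\rangle$. Here $a^\dagger$ is an operator-valued distribution, used only under an integral, and series of operators converge on every vector, pointwise in the correlation functions. Write $a_{1\ldots n}=a_{\alpha_1}(k_1)\cdots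 a_{\alpha_n}(k_n)$ and $a^\dagger_{n\ldots1}=a^\dagger_{\alpha_n}(k_n)\cdots a^\dagger_{\alpha_1}(k_1)$; in $a^\dagger_{n\ldots 1}X_{01\ldots n}a_{1\ldots n}$, with $X_{01\ldots n}$ a matrix on $n+1$ auxiliary spaces $\mathbb C^N$ depending on $k_0,\dots,k_n$, one sums over the indices of the spaces $1,\ldots,n$ and integrates over $k_1,\ldots,k_n$. Let $T(k)$ be the well-bred vertex operator, i.e. an $N\times N$ matrix of operators with $$T_1a_2=R_{21}a_2T_1,\quad T_1a_2^\dagger=a_2^\dagger R_{12}T_1,\quad R_{12}T_1T_2=T_2T_1R_{12},\quad T(k_0)=\mathbb I+\sum_{n\ge1}\frac{(-1)^n}{(n-1)!}\,a^\dagger_{n\ldots1}T^{(n)}_{01\ldots n}a_{1\ldots n},$$ and let $T^{(n)\dagger}$ be coefficients of its two-sided inverse, $$T(k_0)^{-1}=\mathbb I+\sum_{n\ge1}\frac{(-1)^n}{(n-1)!}\,a^\dagger_{n\ldots1}T^{(n)\dagger}_{01\ldots n}a_{1\ldots n}.$$ Let $B(k)$ be a reflection matrix: an $N\times N$ complex matrix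 with $R_{12}(k_1,k_2)B_1(k_1)R_{21}(k_2,-k_1)B_2(k_2)=B_2(k_2)R_{12}(k_1,-k_2)B_1(k_1)R_{21}(-k_2,-k_1)$ and $B(k)B(-k)=\mathbb I$. Then, for all such coefficients $T^{(n)}$, $T^{(n)\dagger}$, the reflection operator $b(k)=T(k)B(k)T(-k)^{-1}$ has the normal-ordered expansion $$b_0=B_0+\sum_{n=1}^\infty\frac{(-1)^n}{(n-1)!}\,a^\dagger_{n\ldots1}\,\beta^{(n)}_{01\ldots n}\,a_{1\ldots n},$$ $$\beta^{(n)}_{01\ldots n}=T^{(n)}_{01\ldots n}B_0\,\mathcal R'_0+B_0\,T'^{(n)\dagger}_{01\ldots n}+(n-1)\sum_{p=1}^{n-1}\binom{n-2}{p-1}\,T^{(n-p)}_{0\,p+1\ldots n}\,B_0\,T'^{(p)\dagger}_{01\ldots p}\,\mathcal R'_p ,$$ where $b_0=b(k_0)$, $B_0=B(k_0)$ acts on the space $0$, the prime on $T'^{(p)\dagger}$ means that $k_0$ is replaced by $-k_0$, and $$\mathcal R'_p=R'_{p+1,0}R'_{p+2,0}\cdots R'_{n0},\qquad R'_{s0}=R_{s0}(k_s,-k_0)\qquad(0\le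 p\le n-1).$$ -/

import Mathlib

/-!
# Zamolodchikov-Faddeev operators on the Fock space, vertex operators, reflection operators

Spectral parameters are real numbers. The auxiliary spaces are copies of `ℂ^N`; a matrix acting on
`n` auxiliary spaces is indexed by `Fin n → Fin N` (one index in `Fin N` for every space).
-/

open scoped Matrix

noncomputable section

namespace ZF

section Aux

variable {A : Type*} [Semiring A] {N n m : ℕ}

/-- `M_s`: the matrix `M` on `ℂ^N`, acting on the auxiliary space `s` of `n` spaces. -/
def oneSite (s : Fin n) (M : Matrix (Fin N) (Fin N) A) :
    Matrix (Fin n → Fin N) (Fin n → Fin N) A :=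
  Matrix.of fun α β => if ∀ r, r ≠ s → α r = β r then M (α s) (β s) else 0

/-- `M_{st}`: the matrix `M` on `ℂ^N ⊗ ℂ^N`, its first tensor factor acting on the auxiliary space
`s` and its second one on the auxiliary space `t`. -/
def twoSite (s t : Fin n) (M : Matrix (Fin N × Fin N) (Fin N × Fin N) A) :
    Matrix (Fin n → Fin N) (Fin n → Fin N) A :=
  Matrix.of fun α β => if ∀ r, r ≠ s → r ≠ t → α r = β r then M (α s, α t) (β s, β t) else 0

/-- `M_{e(0) e(1) … e(m-1)}`: the matrix `M` on `m` spaces, its `j`-th tensor factor acting on the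
auxiliary space `e j` of `n` spaces. -/
def place (e : Fin m → Fin n) (M : Matrix (Fin m → Fin N) (Fin m → Fin N) A) :
    Matrix (Fin n → Fin N) (Fin n → Fin N) A :=
  Matrix.of fun α β => if ∀ r, (∀ j, r ≠ e j) → α r = β r then M (α ∘ e) (β ∘ e) else 0

end Aux

/-- An evaluated `R`-matrix of size `N² × N²` with spectral parameters, obeying the Yang-Baxter
equation and the unitarity condition. -/
structure RMatrix (N : ℕ) where
  /-- the matrix `R(k₁, k₂)`, with entries `R(k₁, k₂) (i₁, i₂) (j₁, j₂)` -/
  R : ℝ → ℝ → Matrix (Fin N × Fin N) (Fin N × Fin N) ℂ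
  yangBaxter : ∀ k₁ k₂ k₃ : ℝ,
    (twoSite 0 1 (R k₁ k₂) * twoSite 0 2 (R k₁ k₃) * twoSite 1 2 (R k₂ k₃) :
        Matrix (Fin 3 → Fin N) (Fin 3 → Fin N) ℂ) =
      twoSite 1 2 (R k₂ k₃) * twoSite 0 2 (R k₁ k₃) * twoSite 0 1 (R k₁ k₂)
  unitarity : ∀ k₁ k₂ : ℝ,
    (twoSite 0 1 (R k₁ k₂) * twoSite 1 0 (R k₂ k₁) :
        Matrix (Fin 2 → Fin N) (Fin 2 → Fin N) ℂ) = 1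

/-- A reflection matrix: `R₁₂ B₁ R'₂₁ B₂ = B₂ R'₁₂ B₁ R̄₂₁` and `B(k) B(-k) = 1`. -/
structure IsReflectionMatrix {N : ℕ} (𝓡 : RMatrix N) (B : ℝ → Matrix (Fin N) (Fin N) ℂ) :
    Prop where
  reflection : ∀ k₁ k₂ : ℝ,
    (twoSite 0 1 (𝓡.R k₁ k₂) * oneSite 0 (B k₁) * twoSite 1 0 (𝓡.R k₂ (-k₁)) * oneSite 1 (B k₂) :
        Matrix (Fin 2 → Fin N) (Fin 2 → Fin N) ℂ) =
      oneSite 1 (B k₂) * twoSite 0 1 (𝓡.R k₁ (-k₂)) * oneSite 0 (B k₁) *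
        twoSite 1 0 (𝓡.R (-k₂) (-k₁))
  inv : ∀ k : ℝ, B k * B (-k) = 1

/-! ### Components of the Yang-Baxter equation and of unitarity -/

section Components

variable {N : ℕ}

theorem sum_fin_two (f : (Fin 2 → Fin N) → ℂ) :
    ∑ α, f α = ∑ a, ∑ b, f ![a, b] := by
  rw [← (finTwoArrowEquiv (Fin N)).symm.sum_comp, Fintype.sum_prod_type]
  rfl

theorem sum_fin_three (f : (Fin 3 → Fin N) → ℂ) :
    ∑ α, f α = ∑ a, ∑ b, ∑ c, f ![a, b, c] := by
  rw [← (Fin.consEquiv (fun _ : Fin 3 => Fin N)).sum_comp, Fintype.sum_prod_type]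
  refine Finset.sum_congr rfl fun a _ => ?_
  exact sum_fin_two _

theorem RMatrix.unit_apply (𝓡 : RMatrix N) (k₁ k₂ : ℝ) (i₁ i₂ j₁ j₂ : Fin N) :
    ∑ a, ∑ b, 𝓡.R k₁ k₂ (i₁, i₂) (a, b) * 𝓡.R k₂ k₁ (b, a) (j₂, j₁) =
      if i₁ = j₁ ∧ i₂ = j₂ then 1 else 0 := by
  have h := congrFun (congrFun (𝓡.unitarity k₁ k₂) ![i₁, i₂]) ![j₁, j₂]
  rw [Matrix.mul_apply, sum_fin_two] at h
  simpa [twoSite, Fin.forall_fin_two, Matrix.one_apply, funext_iff] using h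

theorem twoSite_zero_one (M : Matrix (Fin N × Fin N) (Fin N × Fin N) ℂ) (a b c i j k : Fin N) :
    twoSite (0 : Fin 3) 1 M ![a, b, c] ![i, j, k] = if c = k then M (a, b) (i, j) else 0 := by
  exact if_congr (by simp [Fin.forall_fin_succ]) rfl rfl

theorem twoSite_zero_two (M : Matrix (Fin N × Fin N) (Fin N × Fin N) ℂ) (a b c i j k : Fin N) :
    twoSite (0 : Fin 3) 2 M ![a, b, c] ![i, j, k] = if b = j then M (a, c) (i, k) else 0 := by
  exact if_congr (by simp [Fin.forall_fin_succ]) rfl rfl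

theorem twoSite_one_two (M : Matrix (Fin N × Fin N) (Fin N × Fin N) ℂ) (a b c i j k : Fin N) :
    twoSite (1 : Fin 3) 2 M ![a, b, c] ![i, j, k] = if a = i then M (b, c) (j, k) else 0 := by
  exact if_congr (by simp [Fin.forall_fin_succ]) rfl rfl

theorem RMatrix.yb_apply (𝓡 : RMatrix N) (k₁ k₂ k₃ : ℝ) (i₁ i₂ i₃ j₁ j₂ j₃ : Fin N) :
    ∑ a, ∑ b, ∑ c, 𝓡.R k₁ k₂ (i₁, i₂) (a, b) * 𝓡.R k₁ k₃ (a, i₃) (j₁, c) *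
        𝓡.R k₂ k₃ (b, c) (j₂, j₃) =
      ∑ a, ∑ b, ∑ c, 𝓡.R k₂ k₃ (i₂, i₃) (b, c) * 𝓡.R k₁ k₃ (i₁, c) (a, j₃) *
        𝓡.R k₁ k₂ (a, b) (j₁, j₂) := by
  have h := congrFun (congrFun (𝓡.yangBaxter k₁ k₂ k₃) ![i₁, i₂, i₃]) ![j₁, j₂, j₃]
  have pull : ∀ (p : Prop) [Decidable p] (f : Fin N → ℂ),
      ∑ x, (if p then f x else 0) = if p then ∑ x, f x else 0 := by
    intro p _ f
    split_ifs <;> simp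
  simp only [Matrix.mul_apply, sum_fin_three, twoSite_zero_one, twoSite_zero_two,
    twoSite_one_two, ite_mul, mul_ite, zero_mul, mul_zero, pull, Finset.sum_ite_eq,
    Finset.sum_ite_eq', Finset.mem_univ, if_true, Finset.sum_mul] at h
  convert h using 1
  · rw [Finset.sum_comm]
    refine Finset.sum_congr rfl fun b _ => ?_
    rw [Finset.sum_comm]

end Components

/-! ### The Fock space and the operators `a`, `a†` -/

section Fock

variable {N : ℕ}

/-- The `R`-symmetric Fock space of the ZF algebra. The vector `f` is given by its correlation
functions `f [x₁, …, xₙ] = ⟨Ω| a(xₙ) ⋯ a(x₁) |f⟩`, one function of `n` arguments `x = (k, i)` for every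
particle number `n`; the relation `a₁ a₂ = R₂₁ a₂ a₁` is their symmetry. Vectors with infinitely many
non-zero `n`-particle components are allowed. The functions are evaluated pointwise, so that `a_i(k)`
at a sharp value of `k` is an operator, and no regularity of `R` is needed. -/
def Fock (𝓡 : RMatrix N) : Submodule ℂ (List (ℝ × Fin N) → ℂ) where
  carrier := {f | ∀ (l' l : List (ℝ × Fin N)) (k₁ k₂ : ℝ) (i₁ i₂ : Fin N),
    f (l' ++ (k₂, i₂) :: (k₁, i₁) :: l) =
      ∑ j₂, ∑ j₁, 𝓡.R k₂ k₁ (i₂, i₁) (j₂, j₁) * f (l' ++ (k₁, j₁) :: (k₂, j₂) :: l)}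
  add_mem' := by
    intro f g hf hg l' l k₁ k₂ i₁ i₂
    simp only [Pi.add_apply, hf l' l k₁ k₂ i₁ i₂, hg l' l k₁ k₂ i₁ i₂, mul_add,
      Finset.sum_add_distrib]
  zero_mem' := by
    intro l' l k₁ k₂ i₁ i₂
    simp
  smul_mem' := by
    intro c f hf l' l k₁ k₂ i₁ i₂
    simp only [Pi.smul_apply, hf l' l k₁ k₂ i₁ i₂, smul_eq_mul, Finset.mul_sum]
    refine Finset.sum_congr rfl fun _ _ => Finset.sum_congr rfl fun _ _ => ?_
    ring

/-- The annihilation operator `a_i(k)` on the Fock space. -/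
def ann (𝓡 : RMatrix N) (k : ℝ) (i : Fin N) : Module.End ℂ (Fock 𝓡) where
  toFun f := ⟨fun l => f.1 ((k, i) :: l), fun l' l => f.2 ((k, i) :: l') l⟩
  map_add' _ _ := rfl
  map_smul' _ _ := rfl

/-- The correlation functions of `∫ dq ∑ⱼ a†_j(q) F_j(q)`. They are obtained by moving the
annihilation operator `a_i(k)` through `a†_j(q)` with the exchange relation
`a₁ a†₂ = a†₂ R₁₂ a₁ + δ₁₂`, that is,
`a_i(k) ∫ dq ∑ⱼ a†_j(q) F_j(q) =
  ∫ dq ∑ⱼ a†_j(q) (∑ R(k, q) (i, j) (j₁, j₂) a_{j₁}(k) F_{j₂}(q)) + F_i(k)`,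
and from `⟨Ω| a†_j(q) = 0`. -/
def createFun (𝓡 : RMatrix N) :
    (ℝ → Fin N → List (ℝ × Fin N) → ℂ) → List (ℝ × Fin N) → ℂ
  | _, [] => 0
  | F, (k, i) :: l =>
    createFun 𝓡 (fun q j l' => ∑ j₁, ∑ j₂, 𝓡.R k q (i, j) (j₁, j₂) * F q j₂ ((k, j₁) :: l')) l +
      F k i l

theorem createFun_zero (𝓡 : RMatrix N) (l : List (ℝ × Fin N)) :
    createFun 𝓡 (fun _ _ _ => 0) l = 0 := by
  induction l with
  | nil => rfl
  | cons x l ih => simpa [createFun] using ih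

theorem createFun_add (𝓡 : RMatrix N) (l : List (ℝ × Fin N)) :
    ∀ F G : ℝ → Fin N → List (ℝ × Fin N) → ℂ,
      createFun 𝓡 (fun q j l' => F q j l' + G q j l') l = createFun 𝓡 F l + createFun 𝓡 G l := by
  induction l with
  | nil => intro F G; simp [createFun]
  | cons x l ih =>
    intro F G
    simp only [createFun, mul_add, Finset.sum_add_distrib, ih]
    ring

theorem createFun_smul (𝓡 : RMatrix N) (c : ℂ) (l : List (ℝ × Fin N)) :
    ∀ F : ℝ → Fin N → List (ℝ × Fin N) → ℂ,
      createFun 𝓡 (fun q j l' => c * F q j l') l = c * createFun 𝓡 F l := by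
  induction l with
  | nil => intro F; simp [createFun]
  | cons x l ih =>
    intro F
    simp only [createFun, mul_left_comm _ c, ← Finset.mul_sum, ih, mul_add]

theorem createFun_sum (𝓡 : RMatrix N) {ι : Type*} (s : Finset ι) (l : List (ℝ × Fin N))
    (F : ι → ℝ → Fin N → List (ℝ × Fin N) → ℂ) :
    createFun 𝓡 (fun q j l' => ∑ x ∈ s, F x q j l') l = ∑ x ∈ s, createFun 𝓡 (F x) l := by
  classical
  induction s using Finset.induction_on with
  | empty => simpa using createFun_zero 𝓡 l
  | insert x s hx ih => simp only [Finset.sum_insert hx, createFun_add, ih]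

theorem sum_perm₁ (f : Fin N → Fin N → Fin N → Fin N → Fin N → Fin N → ℂ) :
    ∑ a, ∑ b, ∑ c, ∑ d, ∑ y, ∑ x, f a b c d y x =
      ∑ d, ∑ y, ∑ x, ∑ c, ∑ a, ∑ b, f a b c d y x := by
  simp only [← Fintype.sum_prod_type']
  exact Fintype.sum_equiv
    ⟨fun p => (p.2.2.2.1, p.2.2.2.2.1, p.2.2.2.2.2, p.2.2.1, p.1, p.2.1),
      fun p => (p.2.2.2.2.1, p.2.2.2.2.2, p.2.2.2.1, p.1, p.2.1, p.2.2.1),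
      fun _ => rfl, fun _ => rfl⟩ _ _ fun _ => rfl

theorem sum_perm₂ (f : Fin N → Fin N → Fin N → Fin N → Fin N → Fin N → ℂ) :
    ∑ d, ∑ y, ∑ x, ∑ c, ∑ a, ∑ b, f d y x c a b =
      ∑ c, ∑ a, ∑ y, ∑ b, ∑ x, ∑ d, f d y x c a b := by
  simp only [← Fintype.sum_prod_type']
  exact Fintype.sum_equiv
    ⟨fun p => (p.2.2.2.1, p.2.2.2.2.1, p.2.1, p.2.2.2.2.2, p.2.2.1, p.1),
      fun p => (p.2.2.2.2.2, p.2.2.1, p.2.2.2.2.1, p.1, p.2.1, p.2.2.2.1),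
      fun _ => rfl, fun _ => rfl⟩ _ _ fun _ => rfl

/-- `R₁₃ R₂₃ a₁ a₂ F₃ = R₂₁ R₂₃ R₁₃ a₂ a₁ F₃` in components. -/
theorem exchange_aux (𝓡 : RMatrix N) (G : List (ℝ × Fin N) → Fin N → ℂ) (k₁ k₂ q : ℝ)
    (l : List (ℝ × Fin N)) (i₁ i₂ j : Fin N)
    (sw : ∀ d c a, G ((k₂, c) :: (k₁, a) :: l) d =
      ∑ y, ∑ x, 𝓡.R k₂ k₁ (c, a) (y, x) * G ((k₁, x) :: (k₂, y) :: l) d) :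
    ∑ a, ∑ b, 𝓡.R k₁ q (i₁, j) (a, b) *
        ∑ c, ∑ d, 𝓡.R k₂ q (i₂, b) (c, d) * G ((k₂, c) :: (k₁, a) :: l) d =
      ∑ j₂, ∑ j₁, 𝓡.R k₂ k₁ (i₂, i₁) (j₂, j₁) * ∑ c, ∑ b, 𝓡.R k₂ q (j₂, j) (c, b) *
        ∑ a, ∑ d, 𝓡.R k₁ q (j₁, b) (a, d) * G ((k₁, a) :: (k₂, c) :: l) d := by
  simp only [sw, Finset.mul_sum, ← mul_assoc]
  refine (sum_perm₁ _).trans (Eq.trans ?_ (sum_perm₂ fun d y x c a b =>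
    𝓡.R k₂ k₁ (i₂, i₁) (c, a) * 𝓡.R k₂ q (c, j) (y, b) * 𝓡.R k₁ q (a, b) (x, d) *
      G ((k₁, x) :: (k₂, y) :: l) d))
  refine Finset.sum_congr rfl fun d _ => Finset.sum_congr rfl fun y _ =>
    Finset.sum_congr rfl fun x _ => ?_
  have h := congrArg (· * G ((k₁, x) :: (k₂, y) :: l) d) (𝓡.yb_apply k₂ k₁ q i₂ i₁ j y x d)
  simp only [Finset.sum_mul] at h
  exact h.symm

theorem createFun_mem (𝓡 : RMatrix N) (F : ℝ → Fin N → List (ℝ × Fin N) → ℂ)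
    (hF : ∀ q j, F q j ∈ Fock 𝓡) : createFun 𝓡 F ∈ Fock 𝓡 := by
  intro l'
  induction l' generalizing F with
  | nil =>
    intro l k₁ k₂ i₁ i₂
    simp only [List.nil_append, createFun, mul_add, Finset.sum_add_distrib]
    have e1 : ∑ j₂, ∑ j₁, 𝓡.R k₂ k₁ (i₂, i₁) (j₂, j₁) *
        ∑ a, ∑ b, 𝓡.R k₁ k₂ (j₁, j₂) (a, b) * F k₂ b ((k₁, a) :: l) =
        F k₂ i₂ ((k₁, i₁) :: l) := by
      have : ∀ a b, ∑ j₂, ∑ j₁, 𝓡.R k₂ k₁ (i₂, i₁) (j₂, j₁) * 𝓡.R k₁ k₂ (j₁, j₂) (a, b) =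
          if i₂ = b ∧ i₁ = a then 1 else 0 := fun a b => 𝓡.unit_apply k₂ k₁ i₂ i₁ b a
      calc _ = ∑ a, ∑ b, (∑ j₂, ∑ j₁, 𝓡.R k₂ k₁ (i₂, i₁) (j₂, j₁) *
            𝓡.R k₁ k₂ (j₁, j₂) (a, b)) * F k₂ b ((k₁, a) :: l) := by
            simp only [Finset.mul_sum, Finset.sum_mul, ← mul_assoc]
            simp only [← Fintype.sum_prod_type']
            exact Fintype.sum_equiv ⟨fun p => (p.2.2.1, p.2.2.2, p.1, p.2.1),
              fun p => (p.2.2.1, p.2.2.2, p.1, p.2.1), fun _ => rfl, fun _ => rfl⟩ _ _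
              fun _ => rfl
        _ = _ := by
            simp only [this, ite_mul, one_mul, zero_mul, ite_and]
            simp
    have e2 : createFun 𝓡 (fun q j l' => ∑ a, ∑ b, 𝓡.R k₁ q (i₁, j) (a, b) *
          ∑ c, ∑ d, 𝓡.R k₂ q (i₂, b) (c, d) * F q d ((k₂, c) :: (k₁, a) :: l')) l =
        ∑ j₂, ∑ j₁, 𝓡.R k₂ k₁ (i₂, i₁) (j₂, j₁) * createFun 𝓡 (fun q j l' =>
          ∑ c, ∑ b, 𝓡.R k₂ q (j₂, j) (c, b) *
            ∑ a, ∑ d, 𝓡.R k₁ q (j₁, b) (a, d) * F q d ((k₁, a) :: (k₂, c) :: l')) l := by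
      simp only [← createFun_smul, ← createFun_sum]
      congr 1
      funext q j l'
      exact exchange_aux 𝓡 (fun l d => F q d l) k₁ k₂ q l' i₁ i₂ j
        fun d c a => hF q d [] l' k₁ k₂ a c
    rw [e1, e2]
    ring
  | cons x l' ih =>
    intro l k₁ k₂ i₁ i₂
    obtain ⟨k, i⟩ := x
    simp only [List.cons_append, createFun, mul_add, Finset.sum_add_distrib]
    rw [ih, hF k i l' l k₁ k₂ i₁ i₂]
    intro q j
    have : (fun l' => ∑ j₁, ∑ j₂, 𝓡.R k q (i, j) (j₁, j₂) * F q j₂ ((k, j₁) :: l')) =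
        ∑ j₁, ∑ j₂, 𝓡.R k q (i, j) (j₁, j₂) • (ann 𝓡 k j₁ ⟨F q j₂, hF q j₂⟩).1 := by
      funext l'
      simp [Finset.sum_apply, ann]
    rw [this]
    exact Submodule.sum_mem _ fun j₁ _ => Submodule.sum_mem _ fun j₂ _ =>
      Submodule.smul_mem _ _ (Subtype.property _)

/-- The smeared creation operator `∫ dq ∑ⱼ a†_j(q) F_j(q)`, for a family `F` of Fock space vectors.
(As `a†_j(q)` is an operator valued distribution, only such integrals are vectors.) -/
def create (𝓡 : RMatrix N) (F : ℝ → Fin N → Fock 𝓡) : Fock 𝓡 :=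
  ⟨createFun 𝓡 fun q j => (F q j).1, createFun_mem 𝓡 _ fun q j => (F q j).2⟩

/-- The relation `a₁ a₂ = R₂₁ a₂ a₁`. -/
theorem ann_mul_ann (𝓡 : RMatrix N) (k₁ k₂ : ℝ) (i₁ i₂ : Fin N) :
    ann 𝓡 k₁ i₁ * ann 𝓡 k₂ i₂ =
      ∑ j₂, ∑ j₁, 𝓡.R k₂ k₁ (i₂, i₁) (j₂, j₁) • (ann 𝓡 k₂ j₂ * ann 𝓡 k₁ j₁) := by
  ext f l
  simpa [ann, Module.End.mul_apply, LinearMap.sum_apply, Finset.sum_apply] using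
    f.2 [] l k₁ k₂ i₁ i₂

/-- The relation `a₁ a†₂ = a†₂ R₁₂ a₁ + δ₁₂`, smeared with `F`. -/
theorem ann_create (𝓡 : RMatrix N) (k : ℝ) (i : Fin N) (F : ℝ → Fin N → Fock 𝓡) :
    ann 𝓡 k i (create 𝓡 F) =
      create 𝓡 (fun q j => ∑ j₁, ∑ j₂, 𝓡.R k q (i, j) (j₁, j₂) • ann 𝓡 k j₁ (F q j₂)) + F k i := by
  ext l
  have h : (fun q j => (∑ j₁, ∑ j₂, 𝓡.R k q (i, j) (j₁, j₂) • ann 𝓡 k j₁ (F q j₂)).1) =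
      fun q j l' => ∑ j₁, ∑ j₂, 𝓡.R k q (i, j) (j₁, j₂) * (F q j₂).1 ((k, j₁) :: l') := by
    funext q j l'
    simp [ann, Finset.sum_apply]
  change createFun 𝓡 _ l + (F k i).1 l = createFun 𝓡 _ l + (F k i).1 l
  rw [h]

/-- The operator `a_{β₁}(k₁) a_{β₂}(k₂) ⋯ a_{βₙ}(kₙ)`. -/
def annProd (𝓡 : RMatrix N) {n : ℕ} (k : Fin n → ℝ) (β : Fin n → Fin N) :
    Module.End ℂ (Fock 𝓡) :=
  (List.ofFn fun s => ann 𝓡 (k s) (β s)).prod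

/-- The vector
`∫ dk₁ ⋯ dkₙ ∑_{α₁ … αₙ} a†_{αₙ}(kₙ) ⋯ a†_{α₁}(k₁) G_{α₁ … αₙ}(k₁, …, kₙ)`. -/
def createProd (𝓡 : RMatrix N) :
    (n : ℕ) → ((Fin n → ℝ) → (Fin n → Fin N) → Fock 𝓡) → Fock 𝓡
  | 0, G => G Fin.elim0 Fin.elim0
  | n + 1, G => create 𝓡 fun q j =>
      createProd 𝓡 n fun k α => G (Fin.snoc k q : Fin (n + 1) → ℝ) (Fin.snoc α j : Fin (n + 1) → Fin N)

end Fock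

section VertexOperators

variable {N : ℕ}

/-- A family of numerical coefficients `X⁽ⁿ⁾_{01…n}(k₁, …, kₙ)`, one for every `n`: a matrix on
`n + 1` auxiliary spaces, where `0 : Fin (n + 1)` is the space `0` and `s.succ`, for `s : Fin n`, are
the spaces `1, …, n`. -/
abbrev Coeff (N : ℕ) : Type :=
  (n : ℕ) → (Fin n → ℝ) → Matrix (Fin (n + 1) → Fin N) (Fin (n + 1) → Fin N) ℂ

/-- `N × N` matrices (on the auxiliary space `0`) with entries the operators on the Fock space. -/
abbrev OpMatrix (𝓡 : RMatrix N) : Type :=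
  Matrix (Fin N) (Fin N) (Module.End ℂ (Fock 𝓡))

/-- The entry `(i, j)` in the auxiliary space `0` of the normal ordered operator
`a†_{n…1} X_{01…n} a_{1…n}`, with summation over all indices of the spaces `1, …, n` and integration
over the spectral parameters `k₁, …, kₙ`, applied to the vector `v`. -/
def normalOrdered (𝓡 : RMatrix N) (n : ℕ)
    (X : (Fin n → ℝ) → Matrix (Fin (n + 1) → Fin N) (Fin (n + 1) → Fin N) ℂ)
    (i j : Fin N) (v : Fock 𝓡) : Fock 𝓡 :=
  createProd 𝓡 n fun k α =>
    ∑ β : Fin n → Fin N,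
      X k (Fin.cons i α : Fin (n + 1) → Fin N) (Fin.cons j β : Fin (n + 1) → Fin N) •
        annProd 𝓡 k β v

/-- The normal ordered expansion
`O₀ = C₀ + ∑_{n ≥ 1} (-1)ⁿ / (n-1)! a†_{n…1} X⁽ⁿ⁾_{01…n} a_{1…n}`
(summed with `n + 1` in place of `n`). The series converges on every vector, for the topology of
pointwise convergence of correlation functions, which the Fock space inherits from
`List (ℝ × Fin N) → ℂ`; its terms with `n > m` vanish on the `m`-particle vectors. -/
def HasExpansion (𝓡 : RMatrix N) (O : OpMatrix 𝓡) (C : Matrix (Fin N) (Fin N) ℂ)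
    (X : Coeff N) : Prop :=
  ∀ (i j : Fin N) (v : Fock 𝓡),
    HasSum (fun n : ℕ => ((-1) ^ (n + 1) / (n.factorial : ℂ)) •
      normalOrdered 𝓡 (n + 1) (X (n + 1)) i j v) (O i j v - C i j • v)

/-- A complex matrix, seen as a matrix of operators (scalar multiples of the identity). -/
def scalarOp (𝓡 : RMatrix N) {ι : Type*} (M : Matrix ι ι ℂ) :
    Matrix ι ι (Module.End ℂ (Fock 𝓡)) :=
  M.map (algebraMap ℂ (Module.End ℂ (Fock 𝓡)))

/-- `T(k)` is a well-bred vertex operator, and `T⁽ⁿ⁾_{01…n}(k, k₁, …, kₙ) = t n k (k₁, …, kₙ)` are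
coefficients of its expansion. -/
structure IsWellBred (𝓡 : RMatrix N) (T : ℝ → OpMatrix 𝓡) (t : (n : ℕ) → ℝ → (Fin n → ℝ) →
    Matrix (Fin (n + 1) → Fin N) (Fin (n + 1) → Fin N) ℂ) : Prop where
  expansion : ∀ k : ℝ, HasExpansion 𝓡 (T k) 1 fun n => t n k
  /-- `T₁ a₂ = R₂₁ a₂ T₁` -/
  mul_ann : ∀ (k₁ k₂ : ℝ) (i₁ j₁ i₂ : Fin N),
    T k₁ i₁ j₁ * ann 𝓡 k₂ i₂ =
      ∑ m₂, ∑ m₁, 𝓡.R k₂ k₁ (i₂, i₁) (m₂, m₁) • (ann 𝓡 k₂ m₂ * T k₁ m₁ j₁)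
  /-- `T₁ a†₂ = a†₂ R₁₂ T₁`, smeared with `F` -/
  apply_create : ∀ (k₁ : ℝ) (i₁ j₁ : Fin N) (F : ℝ → Fin N → Fock 𝓡),
    T k₁ i₁ j₁ (create 𝓡 F) =
      create 𝓡 fun k₂ i₂ => ∑ m₁, ∑ j₂, 𝓡.R k₁ k₂ (i₁, i₂) (m₁, j₂) • T k₁ m₁ j₁ (F k₂ j₂)
  /-- `R₁₂ T₁ T₂ = T₂ T₁ R₁₂` -/
  rtt : ∀ k₁ k₂ : ℝ,
    (scalarOp 𝓡 (twoSite 0 1 (𝓡.R k₁ k₂)) * oneSite 0 (T k₁) * oneSite 1 (T k₂) :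
        Matrix (Fin 2 → Fin N) (Fin 2 → Fin N) (Module.End ℂ (Fock 𝓡))) =
      oneSite 1 (T k₂) * oneSite 0 (T k₁) * scalarOp 𝓡 (twoSite 0 1 (𝓡.R k₁ k₂))

/-- The reflection operator `b(k) = T(k) B(k) T(-k)⁻¹`, where `Tinv` is the inverse of `T`. -/
def reflectionOp (𝓡 : RMatrix N) (B : ℝ → Matrix (Fin N) (Fin N) ℂ) (T Tinv : ℝ → OpMatrix 𝓡)
    (k : ℝ) : OpMatrix 𝓡 :=
  T k * scalarOp 𝓡 (B k) * Tinv (-k)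

/-- The ordered product `R'_{p+1,0} ⋯ R'_{n0}`, with `R'_{s0} = R_{s0}(k_s, -k₀)`, on the auxiliary
spaces `0, …, n`. -/
def tailProd (𝓡 : RMatrix N) (n p : ℕ) (k₀ : ℝ) (k : Fin n → ℝ) :
    Matrix (Fin (n + 1) → Fin N) (Fin (n + 1) → Fin N) ℂ :=
  (((List.finRange n).filter fun s : Fin n => p ≤ (s : ℕ)).map
    fun s : Fin n => twoSite s.succ 0 (𝓡.R (k s) (-k₀))).prod

/-- The coefficients of the reflection operator:
`β⁽ⁿ⁾_{01…n} = T⁽ⁿ⁾_{01…n} B₀ 𝓡'₀ + B₀ T'⁽ⁿ⁾†_{01…n} +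
  (n-1) ∑_{p=1}^{n-1} binom(n-2, p-1) T⁽ⁿ⁻ᵖ⁾_{0,p+1…n} B₀ T'⁽ᵖ⁾†_{01…p} 𝓡'ₚ`,
where `𝓡'ₚ` is `tailProd 𝓡 n p` and the prime on `T†` means `-k₀` in place of `k₀`. -/
def reflectionCoeff (𝓡 : RMatrix N) (B : ℝ → Matrix (Fin N) (Fin N) ℂ)
    (t tdag : (n : ℕ) → ℝ → (Fin n → ℝ) →
      Matrix (Fin (n + 1) → Fin N) (Fin (n + 1) → Fin N) ℂ) (k₀ : ℝ) : Coeff N :=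
  fun n k =>
    t n k₀ k * oneSite 0 (B k₀) * tailProd 𝓡 n 0 k₀ k + oneSite 0 (B k₀) * tdag n (-k₀) k +
      ((n : ℂ) - 1) • ∑ p ∈ Finset.univ.filter fun p : Fin n => 0 < (p : ℕ),
        ((n - 2).choose ((p : ℕ) - 1) : ℂ) •
        (place (Fin.cons 0 fun s : Fin (n - p) => Fin.succ ⟨p + s, by omega⟩)
            (t (n - p) k₀ fun s : Fin (n - p) => k ⟨p + s, by omega⟩) *
          oneSite 0 (B k₀) *
          place (Fin.castLE (by omega : (p : ℕ) + 1 ≤ n + 1))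
            (tdag p (-k₀) fun s : Fin p => k (Fin.castLE p.2.le s)) *
          tailProd 𝓡 n p k₀ k)

end VertexOperators

end ZF

end

/-! Expand `T(k₀)` in `T(k₀) B₀ T(-k₀)⁻¹` but keep the inverse whole. A term of order `m` ends in
`m` annihilation operators standing to the left of `T(-k₀)⁻¹`. Multiplying `T₁ a₂ = R₂₁ a₂ T₁` by
the inverse on both sides gives `a₂ T₁⁻¹ = T₁⁻¹ R₂₁ a₂` (`ann_mul_inverse`), so these operators pass
to the right at the cost of the factor `R'₁₀ ⋯ R'_{m0}` (`annProd_mul_inverse`). The inverse now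
stands between the `a†` and the `a`; inserting its expansion there gives products that are already
normal ordered (`normalOrdered_crossCoeff`).

The identity term of the inverse yields `T⁽ⁿ⁾ B₀ 𝓡'₀`, that of `T` yields `B₀ T'⁽ⁿ⁾†`, and the other
pairs yield the sum over `p`. Its weight comes from `(n-1) binom(n-2, p-1) / (n-1)! = 1 / ((p-1)!
(n-p-1)!)` (`expansion_factor_mul`).

Convergence is harmless: a term of order `n` vanishes on correlation functions with fewer than `n`
arguments, so for each argument list all series are finite sums (`hasExpansion_iff`) and the
rearrangement is a finite Cauchy product (`sum_range_mul_range`). -/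

namespace ZF

/-! ### Matrices placed on some of the auxiliary spaces, in components -/

section Placement

variable {N n m p : ℕ}

/-- A matrix placed on the spaces `e`, multiplied from the right, in components. -/
theorem place_mul_apply {e : Fin m → Fin n} (he : Function.Injective e)
    (M : Matrix (Fin m → Fin N) (Fin m → Fin N) ℂ)
    (X : Matrix (Fin n → Fin N) (Fin n → Fin N) ℂ) (α γ : Fin n → Fin N) :
    (place e M * X) α γ = ∑ β, M (α ∘ e) β * X (Function.extend e β α) γ := by
  rw [Matrix.mul_apply]
  symm
  -- Row `α` of the placed matrix is supported on the indices that agree with `α` off the range of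
  -- `e`; these are exactly the `Function.extend e β α`.
  refine Finset.sum_of_injOn (fun β => Function.extend e β α) ?_ (fun _ _ => Finset.mem_coe.2 (Finset.mem_univ _)) ?_ ?_
  · intro β _ β' _ h
    funext j
    simpa [he.extend_apply] using congrFun h (e j)
  · intro δ _ hδ
    have : ¬ ∀ r, (∀ j, r ≠ e j) → α r = δ r := by
      intro h
      refine hδ ⟨δ ∘ e, by simp, ?_⟩
      funext r
      by_cases hr : ∃ j, e j = r
      · obtain ⟨j, rfl⟩ := hr
        simp [he.extend_apply]
      · simp only [Function.extend_apply' _ _ _ hr]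
        exact h r fun j hj => hr ⟨j, hj.symm⟩
    simp [place, this]
  · intro β _
    have h1 : ∀ r, (∀ j, r ≠ e j) → α r = Function.extend e β α r := fun r hr => by
      rw [Function.extend_apply']
      rintro ⟨j, hj⟩
      exact hr j hj.symm
    have h2 : Function.extend e β α ∘ e = β := by
      funext j
      simp [he.extend_apply]
    simp only [place, Matrix.of_apply]
    rw [if_pos h1, h2]

theorem place_mul {e : Fin m → Fin n} (he : Function.Injective e)
    (M M' : Matrix (Fin m → Fin N) (Fin m → Fin N) ℂ) :
    place e (M * M') = place e M * place e M' := by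
  ext α γ
  rw [place_mul_apply he]
  have h2 : ∀ β, Function.extend e β α ∘ e = β := fun β => by
    funext j
    simp [he.extend_apply]
  have h1 : ∀ β, (∀ r, (∀ j, r ≠ e j) → Function.extend e β α r = γ r) ↔
      ∀ r, (∀ j, r ≠ e j) → α r = γ r := fun β => by
    refine forall₂_congr fun r hr => ?_
    rw [Function.extend_apply']
    rintro ⟨j, hj⟩
    exact hr j hj.symm
  simp only [place, Matrix.of_apply, h1, h2, Matrix.mul_apply]
  split_ifs <;> simp

theorem place_one {e : Fin m → Fin n} :
    place e (1 : Matrix (Fin m → Fin N) (Fin m → Fin N) ℂ) = 1 := by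
  ext α β
  simp only [place, Matrix.of_apply, Matrix.one_apply]
  have : α = β ↔ (∀ r, (∀ j, r ≠ e j) → α r = β r) ∧ α ∘ e = β ∘ e := by
    refine ⟨by rintro rfl; simp, fun ⟨h, h'⟩ => funext fun r => ?_⟩
    by_cases hr : ∃ j, r = e j
    · obtain ⟨j, rfl⟩ := hr
      exact congrFun h' j
    · exact h r (by simpa using hr)
  by_cases h1 : ∀ r, (∀ j, r ≠ e j) → α r = β r <;> by_cases h2 : α ∘ e = β ∘ e <;>
    simp [this, h1, h2]

theorem place_twoSite {e : Fin m → Fin n} (he : Function.Injective e) (s t : Fin m)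
    (M : Matrix (Fin N × Fin N) (Fin N × Fin N) ℂ) :
    place e (twoSite s t M) = twoSite (e s) (e t) M := by
  ext α β
  simp only [place, twoSite, Matrix.of_apply, Function.comp_apply, ← ite_and]
  refine if_congr ⟨fun ⟨h, h'⟩ r hs ht => ?_, fun h => ⟨fun r hr => h r (hr s) (hr t), fun r hs ht =>
    h _ (he.ne hs) (he.ne ht)⟩⟩ rfl rfl
  by_cases hr : ∃ j, r = e j
  · obtain ⟨j, rfl⟩ := hr
    exact h' j (fun h => hs (h ▸ rfl)) (fun h => ht (h ▸ rfl))
  · exact h r (by simpa using hr)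

theorem place_list_prod {e : Fin m → Fin n} (he : Function.Injective e)
    (L : List (Matrix (Fin m → Fin N) (Fin m → Fin N) ℂ)) :
    place e L.prod = (L.map (place e)).prod := by
  induction L with
  | nil => exact place_one
  | cons M L ih => simp [place_mul he, ih]

/-- The spaces `0, p + 1, …, p + m` among the spaces `0, …, p + m`. -/
def outerSites (p m : ℕ) : Fin (m + 1) → Fin (p + m + 1) :=
  Fin.cons 0 fun s => (Fin.natAdd p s).succ

/-- The spaces `0, …, p` among the spaces `0, …, p + m`. -/
def innerSites (p m : ℕ) : Fin (p + 1) → Fin (p + m + 1) :=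
  Fin.cons 0 fun s => (Fin.castAdd m s).succ

theorem outerSites_injective (p m : ℕ) : Function.Injective (outerSites p m) :=
  Fin.cons_injective_iff.2 ⟨by simp [Fin.succ_ne_zero],
    (Fin.succ_injective _).comp (Fin.natAdd_injective _ _)⟩

theorem innerSites_injective (p m : ℕ) : Function.Injective (innerSites p m) :=
  Fin.cons_injective_iff.2 ⟨by simp [Fin.succ_ne_zero],
    (Fin.succ_injective _).comp (Fin.castAdd_injective _ _)⟩

theorem cons_append_comp_outerSites (i : Fin N) (α' : Fin p → Fin N) (α : Fin m → Fin N) :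
    (Fin.cons i (Fin.append α' α) : Fin (p + m + 1) → Fin N) ∘ outerSites p m = Fin.cons i α := by
  funext r
  refine Fin.cases ?_ (fun s => ?_) r <;> simp [outerSites]

theorem cons_append_comp_innerSites (i : Fin N) (α' : Fin p → Fin N) (α : Fin m → Fin N) :
    (Fin.cons i (Fin.append α' α) : Fin (p + m + 1) → Fin N) ∘ innerSites p m = Fin.cons i α' := by
  funext r
  refine Fin.cases ?_ (fun s => ?_) r <;> simp [innerSites]

/-- A matrix on the outer spaces changes the index of the space `0` and the last block; the first
block `α'` is a spectator. -/
theorem extend_outerSites (i x : Fin N) (α' : Fin p → Fin N) (α β : Fin m → Fin N) :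
    Function.extend (outerSites p m) (Fin.cons x β : Fin (m + 1) → Fin N)
      (Fin.cons i (Fin.append α' α) : Fin (p + m + 1) → Fin N) = Fin.cons x (Fin.append α' β) := by
  have key := (outerSites_injective p m).extend_apply (Fin.cons x β : Fin (m + 1) → Fin N)
    (Fin.cons i (Fin.append α' α) : Fin (p + m + 1) → Fin N)
  funext r
  refine Fin.cases (key 0) (fun s => Fin.addCases (fun s => ?_) (fun s => ?_) s) r
  · rw [Function.extend_apply']
    · simp
    · rintro ⟨j, hj⟩
      revert hj
      refine Fin.cases (fun h => ?_) (fun j h => ?_) j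
      · exact Fin.succ_ne_zero _ h.symm
      · have h : (Fin.natAdd p j).succ = (Fin.castAdd m s).succ := h
        have := congrArg Fin.val h
        simp only [Fin.val_succ, Fin.val_natAdd, Fin.val_castAdd] at this
        omega
  · refine (key s.succ).trans ?_
    simp

theorem extend_innerSites (i x : Fin N) (α' β : Fin p → Fin N) (α : Fin m → Fin N) :
    Function.extend (innerSites p m) (Fin.cons x β : Fin (p + 1) → Fin N)
      (Fin.cons i (Fin.append α' α) : Fin (p + m + 1) → Fin N) = Fin.cons x (Fin.append β α) := by
  have key := (innerSites_injective p m).extend_apply (Fin.cons x β : Fin (p + 1) → Fin N)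
    (Fin.cons i (Fin.append α' α) : Fin (p + m + 1) → Fin N)
  funext r
  refine Fin.cases (key 0) (fun s => Fin.addCases (fun s => ?_) (fun s => ?_) s) r
  · refine (key s.succ).trans ?_
    simp
  · rw [Function.extend_apply']
    · simp
    · rintro ⟨j, hj⟩
      revert hj
      refine Fin.cases (fun h => ?_) (fun j h => ?_) j
      · exact Fin.succ_ne_zero _ h.symm
      · have h : (Fin.castAdd m j).succ = (Fin.natAdd p s).succ := h
        have := congrArg Fin.val h
        simp only [Fin.val_succ, Fin.val_natAdd, Fin.val_castAdd] at this
        omega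

theorem sum_fin_cons {A : Type*} [AddCommMonoid A] (f : (Fin (n + 1) → Fin N) → A) :
    ∑ α, f α = ∑ x, ∑ β : Fin n → Fin N, f (Fin.cons x β) := by
  rw [← (Fin.consEquiv (fun _ : Fin (n + 1) => Fin N)).sum_comp, Fintype.sum_prod_type]
  rfl

theorem outer_mul_apply (M : Matrix (Fin (m + 1) → Fin N) (Fin (m + 1) → Fin N) ℂ)
    (X : Matrix (Fin (p + m + 1) → Fin N) (Fin (p + m + 1) → Fin N) ℂ) (i : Fin N)
    (α' : Fin p → Fin N) (α : Fin m → Fin N) (γ : Fin (p + m + 1) → Fin N) :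
    (place (outerSites p m) M * X) (Fin.cons i (Fin.append α' α)) γ =
      ∑ x, ∑ β, M (Fin.cons i α) (Fin.cons x β) * X (Fin.cons x (Fin.append α' β)) γ := by
  rw [place_mul_apply (outerSites_injective p m), sum_fin_cons]
  simp only [cons_append_comp_outerSites, extend_outerSites]

theorem inner_mul_apply (M : Matrix (Fin (p + 1) → Fin N) (Fin (p + 1) → Fin N) ℂ)
    (X : Matrix (Fin (p + m + 1) → Fin N) (Fin (p + m + 1) → Fin N) ℂ) (i : Fin N)
    (α' : Fin p → Fin N) (α : Fin m → Fin N) (γ : Fin (p + m + 1) → Fin N) :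
    (place (innerSites p m) M * X) (Fin.cons i (Fin.append α' α)) γ =
      ∑ x, ∑ β, M (Fin.cons i α') (Fin.cons x β) * X (Fin.cons x (Fin.append β α)) γ := by
  rw [place_mul_apply (innerSites_injective p m), sum_fin_cons]
  simp only [cons_append_comp_innerSites, extend_innerSites]

/-- For the tail product, which is the last factor of a cross coefficient: there its bare entries
are needed, not its action on a further matrix. -/
theorem place_outer_apply (M : Matrix (Fin (m + 1) → Fin N) (Fin (m + 1) → Fin N) ℂ)
    (z j : Fin N) (β' δ : Fin p → Fin N) (β γ : Fin m → Fin N) :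
    place (outerSites p m) M (Fin.cons z (Fin.append β' β)) (Fin.cons j (Fin.append δ γ)) =
      if β' = δ then M (Fin.cons z β) (Fin.cons j γ) else 0 := by
  simp only [place, Matrix.of_apply, cons_append_comp_outerSites]
  refine if_congr ⟨fun h => funext fun s => ?_, ?_⟩ rfl rfl
  · have := h (Fin.castAdd m s).succ ?_
    · simpa using this
    · refine Fin.cases ?_ fun j h => ?_
      · simp [outerSites, Fin.succ_ne_zero]
      · have h : (Fin.castAdd m s).succ = (Fin.natAdd p j).succ := h
        have := congrArg Fin.val h
        simp only [Fin.val_succ, Fin.val_natAdd, Fin.val_castAdd] at this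
        omega
  · rintro rfl r hr
    revert hr
    refine Fin.cases (fun h => (h 0 rfl).elim)
      (fun s => Fin.addCases (fun s _ => ?_) (fun s h => (h s.succ rfl).elim) s) r
    simp

theorem oneSite_zero_mul_apply (B : Matrix (Fin N) (Fin N) ℂ)
    (X : Matrix (Fin (n + 1) → Fin N) (Fin (n + 1) → Fin N) ℂ) (x : Fin N) (ω : Fin n → Fin N)
    (γ : Fin (n + 1) → Fin N) :
    (oneSite 0 B * X : Matrix (Fin (n + 1) → Fin N) (Fin (n + 1) → Fin N) ℂ) (Fin.cons x ω) γ = ∑ y, B x y * X (Fin.cons y ω) γ := by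
  rw [Matrix.mul_apply, sum_fin_cons]
  refine Finset.sum_congr rfl fun y _ => ?_
  have : ∀ β : Fin n → Fin N, (∀ r : Fin (n + 1), r ≠ 0 →
      (Fin.cons x ω : Fin (n + 1) → Fin N) r = (Fin.cons y β : Fin (n + 1) → Fin N) r) ↔
      ω = β := fun β =>
    ⟨fun h => funext fun s => by simpa using h s.succ (Fin.succ_ne_zero s), by
      rintro rfl r hr
      obtain ⟨s, rfl⟩ := Fin.exists_succ_eq.2 hr
      simp⟩
  simp [oneSite, this]

theorem twoSite_first_mul_apply (M : Matrix (Fin N × Fin N) (Fin N × Fin N) ℂ)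
    (X : Matrix (Fin (n + 2) → Fin N) (Fin (n + 2) → Fin N) ℂ) (w b : Fin N) (ω : Fin n → Fin N)
    (γ : Fin (n + 2) → Fin N) :
    (twoSite (Fin.succ 0) 0 M * X : Matrix (Fin (n + 2) → Fin N) (Fin (n + 2) → Fin N) ℂ)
        (Fin.cons w (Fin.cons b ω)) γ =
      ∑ z, ∑ c, M (b, w) (c, z) * X (Fin.cons z (Fin.cons c ω)) γ := by
  rw [Matrix.mul_apply, sum_fin_cons]
  refine Finset.sum_congr rfl fun z _ => ?_
  rw [sum_fin_cons]
  refine Finset.sum_congr rfl fun c _ => ?_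
  have : ∀ β : Fin n → Fin N, (∀ r : Fin (n + 2), r ≠ Fin.succ 0 → r ≠ 0 →
      (Fin.cons w (Fin.cons b ω : Fin (n + 1) → Fin N) : Fin (n + 2) → Fin N) r =
        (Fin.cons z (Fin.cons c β : Fin (n + 1) → Fin N) : Fin (n + 2) → Fin N) r) ↔
      ω = β := fun β =>
    ⟨fun h => funext fun s => by
      simpa using h s.succ.succ ((Fin.succ_injective _).ne (Fin.succ_ne_zero s))
        (Fin.succ_ne_zero _), by
      rintro rfl r hr hr'
      obtain ⟨s, rfl⟩ := Fin.exists_succ_eq.2 hr'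
      obtain ⟨s, rfl⟩ := Fin.exists_succ_eq.2 fun h => hr (congrArg Fin.succ h)
      simp⟩
  simp only [twoSite, Matrix.of_apply, this]
  simp [Fin.cons_zero]

end Placement

/-! ### The ordered products of the matrices `R'_{s0}` -/

section Tail

variable {N : ℕ} (𝓡 : RMatrix N)

theorem finRange_filter_le (p m : ℕ) :
    (List.finRange (p + m)).filter (fun s : Fin (p + m) => p ≤ (s : ℕ)) =
      (List.finRange m).map (Fin.natAdd p) := by
  apply (List.map_injective_iff.2 Fin.val_injective)
  have h1 : (List.finRange (p + m)).map Fin.val = List.range p ++ (List.range m).map (p + ·) := by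
    rw [List.map_coe_finRange_eq_range, List.range_add]
  have h2 : (List.range p).filter (fun s => decide (p ≤ s)) = [] := by
    simp
  have h3 : ((List.range m).map (p + ·)).filter (fun s => decide (p ≤ s)) =
      (List.range m).map (p + ·) := by
    simp
  have h4 : ((List.finRange (p + m)).filter (fun s : Fin (p + m) => p ≤ (s : ℕ))).map Fin.val =
      ((List.finRange (p + m)).map Fin.val).filter (fun s => decide (p ≤ s)) := by
    rw [List.filter_map]
    rfl
  rw [h4, h1, List.filter_append, h2, h3, List.nil_append, List.map_map,
    ← List.map_coe_finRange_eq_range, List.map_map]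
  rfl

/-- The factors with `s > p` touch only the space `0` and the outer block, so the truncated product
is a complete one on fewer spaces. -/
theorem tailProd_add (p m : ℕ) (k₀ : ℝ) (k : Fin (p + m) → ℝ) :
    tailProd 𝓡 (p + m) p k₀ k =
      place (outerSites p m) (tailProd 𝓡 m 0 k₀ fun s => k (Fin.natAdd p s)) := by
  rw [tailProd, tailProd, place_list_prod (outerSites_injective p m), finRange_filter_le]
  simp only [Nat.zero_le, decide_true, List.filter_true, List.map_map]
  congr 1
  refine List.map_congr_left fun s _ => ?_
  exact (place_twoSite (outerSites_injective p m) s.succ 0 _).symm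

/-- Splits off the leftmost factor, which arises from the annihilation operator that crosses `T⁻¹`
last. This is the recursion behind `annProd_mul_inverse`. -/
theorem tailProd_cons (m : ℕ) (k₀ q : ℝ) (k : Fin m → ℝ) (w b j c : Fin N) (β γ : Fin m → Fin N) :
    tailProd 𝓡 (m + 1) 0 k₀ (Fin.cons q k) (Fin.cons w (Fin.cons b β)) (Fin.cons j (Fin.cons c γ)) =
      ∑ z, 𝓡.R q (-k₀) (b, w) (c, z) * tailProd 𝓡 m 0 k₀ k (Fin.cons z β) (Fin.cons j γ) := by
  have he : Function.Injective (Fin.cons 0 fun s : Fin m => s.succ.succ : Fin (m + 1) → Fin (m + 2)) :=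
    Fin.cons_injective_iff.2 ⟨by simp [Fin.succ_ne_zero],
      (Fin.succ_injective _).comp (Fin.succ_injective _)⟩
  have h : tailProd 𝓡 (m + 1) 0 k₀ (Fin.cons q k) = twoSite (Fin.succ 0) 0 (𝓡.R q (-k₀)) *
      place (Fin.cons 0 fun s : Fin m => s.succ.succ : Fin (m + 1) → Fin (m + 2))
        (tailProd 𝓡 m 0 k₀ k) := by
    rw [tailProd, tailProd, place_list_prod he]
    simp only [Nat.zero_le, decide_true, List.filter_true, List.map_map, List.finRange_succ,
      List.map_cons, List.prod_cons, Fin.cons_zero]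
    congr 2
    refine List.map_congr_left fun s _ => ?_
    simp [place_twoSite he]
  rw [h, twoSite_first_mul_apply]
  refine Finset.sum_congr rfl fun z _ => ?_
  have key : ∀ d, place (Fin.cons 0 fun s : Fin m => s.succ.succ : Fin (m + 1) → Fin (m + 2))
      (tailProd 𝓡 m 0 k₀ k) (Fin.cons z (Fin.cons d β)) (Fin.cons j (Fin.cons c γ)) =
      if d = c then tailProd 𝓡 m 0 k₀ k (Fin.cons z β) (Fin.cons j γ) else 0 := fun d => by
    simp only [place, Matrix.of_apply]
    refine if_congr ⟨fun h => ?_, ?_⟩ ?_ rfl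
    · simpa using h (Fin.succ 0) (by
        refine Fin.cases (by simp) fun s => ?_
        simpa using ((Fin.succ_injective _).ne (Fin.succ_ne_zero s)).symm)
    · rintro rfl r hr
      revert hr
      refine Fin.cases (fun h => (h 0 rfl).elim) (fun r => Fin.cases (fun _ => rfl)
        (fun s h => (h s.succ rfl).elim) r) r
    · congr 1 <;> (funext r; refine Fin.cases rfl (fun s => ?_) r; simp)
  simp [key]

end Tail

end ZF

namespace ZF

/-! ### Creation operators, normal ordering and truncation of expansions -/

section Creation

variable {N : ℕ} (𝓡 : RMatrix N)

/-- The `n`-particle component of `∫ a† F` depends on the `(n-1)`-particle components of `F` only. -/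
theorem createFun_congr (l : List (ℝ × Fin N)) :
    ∀ F G : ℝ → Fin N → List (ℝ × Fin N) → ℂ,
      (∀ q j l', l'.length + 1 = l.length → F q j l' = G q j l') →
        createFun 𝓡 F l = createFun 𝓡 G l := by
  induction l with
  | nil => intro F G _; rfl
  | cons x l ih =>
    intro F G h
    simp only [createFun]
    rw [h _ _ l rfl]
    congr 1
    refine ih _ _ fun q j l' hl => ?_
    refine Finset.sum_congr rfl fun _ _ => Finset.sum_congr rfl fun _ _ => ?_
    rw [h q _ _ (by simpa using hl)]

/-- Each creation operator uses up one argument of the correlation function. This allows a series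
under the integral to be replaced by a truncation chosen from `l` alone. -/
theorem createProd_apply_congr (n : ℕ) :
    ∀ (G G' : (Fin n → ℝ) → (Fin n → Fin N) → Fock 𝓡) (l : List (ℝ × Fin N)),
      (∀ k α l', l'.length + n = l.length → (G k α).1 l' = (G' k α).1 l') →
        (createProd 𝓡 n G).1 l = (createProd 𝓡 n G').1 l := by
  induction n with
  | zero => exact fun G G' l h => h _ _ l rfl
  | succ n ih =>
    intro G G' l h
    refine createFun_congr 𝓡 l _ _ fun q j l' hl => ih _ _ l' fun k α l'' hl' => ?_
    exact h _ _ l'' (by omega)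

theorem create_smul (c : ℂ) (F : ℝ → Fin N → Fock 𝓡) :
    create 𝓡 (fun q j => c • F q j) = c • create 𝓡 F :=
  Subtype.ext <| funext fun l => createFun_smul 𝓡 c l fun q j => (F q j).1

theorem create_sum {ι : Type*} (s : Finset ι) (F : ι → ℝ → Fin N → Fock 𝓡) :
    create 𝓡 (fun q j => ∑ x ∈ s, F x q j) = ∑ x ∈ s, create 𝓡 (F x) := by
  ext l
  have h : (fun q j => (∑ x ∈ s, F x q j).1) = fun q j l' => ∑ x ∈ s, (F x q j).1 l' := by
    funext q j l'
    simp [Finset.sum_apply]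
  have h' : (∑ x ∈ s, create 𝓡 (F x)).1 l = ∑ x ∈ s, (create 𝓡 (F x)).1 l := by
    simp [Finset.sum_apply]
  change createFun 𝓡 (fun q j => (∑ x ∈ s, F x q j).1) l = (∑ x ∈ s, create 𝓡 (F x)).1 l
  rw [h, h', createFun_sum]
  rfl

theorem createProd_smul (c : ℂ) (n : ℕ) :
    ∀ G : (Fin n → ℝ) → (Fin n → Fin N) → Fock 𝓡,
      createProd 𝓡 n (fun k α => c • G k α) = c • createProd 𝓡 n G := by
  induction n with
  | zero => intro G; rfl
  | succ n ih =>
    intro G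
    simp only [createProd, ih, create_smul]

theorem createProd_sum {ι : Type*} (s : Finset ι) (n : ℕ) :
    ∀ G : ι → (Fin n → ℝ) → (Fin n → Fin N) → Fock 𝓡,
      createProd 𝓡 n (fun k α => ∑ x ∈ s, G x k α) = ∑ x ∈ s, createProd 𝓡 n (G x) := by
  induction n with
  | zero => intro G; rfl
  | succ n ih =>
    intro G
    simp only [createProd, ih, create_sum]

theorem createProd_add (n : ℕ) (G H : (Fin n → ℝ) → (Fin n → Fin N) → Fock 𝓡) :
    createProd 𝓡 n (fun k α => G k α + H k α) = createProd 𝓡 n G + createProd 𝓡 n H := by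
  have := createProd_sum 𝓡 Finset.univ n fun b : Bool => bif b then G else H
  simpa using this

/-- `a†_{n…p+1} a†_{p…1} = a†_{n…1}` -/
theorem createProd_createProd (p m : ℕ) :
    ∀ G : (Fin (p + m) → ℝ) → (Fin (p + m) → Fin N) → Fock 𝓡,
      createProd 𝓡 m (fun k α => createProd 𝓡 p fun k' α' =>
        G (Fin.append k' k) (Fin.append α' α)) = createProd 𝓡 (p + m) G := by
  induction m with
  | zero =>
    intro G
    have h : ∀ {A : Type} (x : Fin p → A) (y : Fin 0 → A), Fin.append x y = x := fun x y => by
      funext i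
      exact Fin.append_left x y i
    simp only [createProd, h]
    rfl
  | succ m ih =>
    intro G
    -- The outermost creation operator carries the last index, so it is peeled off the right block
    -- by `Fin.snoc`.
    simp only [createProd, Fin.append_snoc]
    congr 1
    funext q j
    exact ih fun k α => G (Fin.snoc k q : Fin (p + m + 1) → ℝ) (Fin.snoc α j : Fin (p + m + 1) → Fin N)

/-- `a_{1…p} a_{p+1…n} = a_{1…n}` -/
theorem annProd_append {p m : ℕ} (k' : Fin p → ℝ) (k : Fin m → ℝ) (β' : Fin p → Fin N)
    (β : Fin m → Fin N) :
    annProd 𝓡 (Fin.append k' k) (Fin.append β' β) = annProd 𝓡 k' β' * annProd 𝓡 k β := by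
  rw [annProd, annProd, annProd, ← List.prod_append, ← List.ofFn_fin_append]
  congr 2
  funext s
  refine Fin.addCases (fun s => ?_) (fun s => ?_) s <;> simp

theorem annProd_cons {m : ℕ} (q : ℝ) (k : Fin m → ℝ) (b : Fin N) (β : Fin m → Fin N) :
    annProd 𝓡 (Fin.cons q k : Fin (m + 1) → ℝ) (Fin.cons b β : Fin (m + 1) → Fin N) =
      ann 𝓡 q b * annProd 𝓡 k β := by
  simp [annProd, List.ofFn_succ]

/-- No list `l'` has `l'.length + n = l.length`, so the integrand may be replaced by zero. -/
theorem normalOrdered_apply_eq_zero (n : ℕ)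
    (X : (Fin n → ℝ) → Matrix (Fin (n + 1) → Fin N) (Fin (n + 1) → Fin N) ℂ)
    (i j : Fin N) (v : Fock 𝓡) (l : List (ℝ × Fin N)) (hl : l.length < n) :
    (normalOrdered 𝓡 n X i j v).1 l = 0 := by
  have h0 : createProd 𝓡 n (fun _ _ => (0 : Fock 𝓡)) = 0 := by
    simpa using createProd_sum 𝓡 (∅ : Finset ℕ) n fun _ _ _ => 0
  have := createProd_apply_congr 𝓡 n (fun k α => ∑ β : Fin n → Fin N,
      X k (Fin.cons i α : Fin (n + 1) → Fin N) (Fin.cons j β : Fin (n + 1) → Fin N) •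
        annProd 𝓡 k β v) (fun _ _ => 0) l fun k α l' h => by omega
  rw [h0] at this
  exact this

theorem normalOrdered_sum {ι : Type*} (s : Finset ι) (n : ℕ)
    (X : ι → (Fin n → ℝ) → Matrix (Fin (n + 1) → Fin N) (Fin (n + 1) → Fin N) ℂ)
    (i j : Fin N) (v : Fock 𝓡) :
    normalOrdered 𝓡 n (fun k => ∑ x ∈ s, X x k) i j v = ∑ x ∈ s, normalOrdered 𝓡 n (X x) i j v := by
  simp only [normalOrdered, ← createProd_sum]
  congr 1
  funext k α
  rw [Finset.sum_comm]
  simp only [Matrix.sum_apply, Finset.sum_smul]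

theorem normalOrdered_smul (c : ℂ) (n : ℕ)
    (X : (Fin n → ℝ) → Matrix (Fin (n + 1) → Fin N) (Fin (n + 1) → Fin N) ℂ)
    (i j : Fin N) (v : Fock 𝓡) :
    normalOrdered 𝓡 n (fun k => c • X k) i j v = c • normalOrdered 𝓡 n X i j v := by
  simp only [normalOrdered, ← createProd_smul, Matrix.smul_apply, Finset.smul_sum, smul_smul,
    smul_eq_mul]

theorem normalOrdered_add (n : ℕ)
    (X Y : (Fin n → ℝ) → Matrix (Fin (n + 1) → Fin N) (Fin (n + 1) → Fin N) ℂ)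
    (i j : Fin N) (v : Fock 𝓡) :
    normalOrdered 𝓡 n (fun k => X k + Y k) i j v =
      normalOrdered 𝓡 n X i j v + normalOrdered 𝓡 n Y i j v := by
  simp only [normalOrdered, ← createProd_add, Matrix.add_apply, add_smul, Finset.sum_add_distrib]

/-- An expansion amounts to finite sums, for each correlation function. -/
theorem hasExpansion_iff (O : OpMatrix 𝓡) (C : Matrix (Fin N) (Fin N) ℂ) (X : Coeff N) :
    HasExpansion 𝓡 O C X ↔ ∀ (i j : Fin N) (v : Fock 𝓡) (l : List (ℝ × Fin N)) (L : ℕ),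
      l.length ≤ L → (O i j v).1 l = C i j * v.1 l + ∑ n ∈ Finset.range L,
        (-1) ^ (n + 1) / (n.factorial : ℂ) * (normalOrdered 𝓡 (n + 1) (X (n + 1)) i j v).1 l := by
  refine forall₃_congr fun i j v => ?_
  -- Any bound `L` is allowed, not only `l.length`, so that one truncation also serves the shorter
  -- lists met under creation operators.
  have h0 : ∀ (l : List (ℝ × Fin N)) (L : ℕ), l.length ≤ L → HasSum (fun n : ℕ =>
      (-1) ^ (n + 1) / (n.factorial : ℂ) * (normalOrdered 𝓡 (n + 1) (X (n + 1)) i j v).1 l)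
      (∑ n ∈ Finset.range L, (-1) ^ (n + 1) / (n.factorial : ℂ) *
        (normalOrdered 𝓡 (n + 1) (X (n + 1)) i j v).1 l) := fun l L hL =>
    hasSum_sum_of_ne_finset_zero fun n hn => by
      rw [normalOrdered_apply_eq_zero, mul_zero]
      rw [Finset.mem_range] at hn
      omega
  have h1 : HasSum (fun n : ℕ => ((-1) ^ (n + 1) / (n.factorial : ℂ)) •
      normalOrdered 𝓡 (n + 1) (X (n + 1)) i j v) (O i j v - C i j • v) ↔
      ∀ l, HasSum (fun n : ℕ => (-1) ^ (n + 1) / (n.factorial : ℂ) *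
        (normalOrdered 𝓡 (n + 1) (X (n + 1)) i j v).1 l) ((O i j v).1 l - C i j * v.1 l) := by
    -- The topology is induced from a product, so convergence is tested on each argument list.
    rw [← Topology.IsInducing.subtypeVal.hasSum_iff (g := (Fock 𝓡).subtype), Pi.hasSum]
    rfl
  rw [h1]
  refine forall_congr' fun l => ⟨fun h L hL => ?_, fun h => ?_⟩
  · exact (sub_eq_iff_eq_add'.1 (h.unique (h0 l L hL)))
  · exact (sub_eq_iff_eq_add'.2 (h l.length le_rfl)) ▸ h0 l _ le_rfl

end Creation

end ZF

namespace ZF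

/-! ### Moving annihilation operators through the inverse -/

section Exchange

variable {N : ℕ} (𝓡 : RMatrix N)

/-- `a₂ T₁⁻¹ = T₁⁻¹ R₂₁ a₂` -/
theorem ann_mul_inverse {S Sinv : OpMatrix 𝓡} {κ : ℝ} (h₁ : S * Sinv = 1) (h₂ : Sinv * S = 1)
    (hS : ∀ (k : ℝ) (i₁ j₁ i₂ : Fin N), S i₁ j₁ * ann 𝓡 k i₂ =
      ∑ m₂, ∑ m₁, 𝓡.R k κ (i₂, i₁) (m₂, m₁) • (ann 𝓡 k m₂ * S m₁ j₁))
    (k : ℝ) (b y j : Fin N) :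
    ann 𝓡 k b * Sinv y j = ∑ z, ∑ c, 𝓡.R k κ (b, z) (c, j) • (Sinv y z * ann 𝓡 k c) := by
  have e₁ : ∀ m, ∑ x, S m x * Sinv x j = if m = j then 1 else 0 := fun m => by
    rw [← Matrix.mul_apply, h₁, Matrix.one_apply]
  have e₂ : ∀ x, ∑ z, Sinv y z * S z x = if y = x then 1 else 0 := fun x => by
    rw [← Matrix.mul_apply, h₂, Matrix.one_apply]
  have e₃ : ∀ z, ∑ x, S z x * ann 𝓡 k b * Sinv x j =
      ∑ c, 𝓡.R k κ (b, z) (c, j) • ann 𝓡 k c := fun z => by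
    simp only [hS, Finset.sum_mul, smul_mul_assoc, mul_assoc]
    rw [Finset.sum_comm]
    refine Finset.sum_congr rfl fun c _ => ?_
    rw [Finset.sum_comm]
    simp only [← Finset.smul_sum, ← Finset.mul_sum, e₁]
    simp
  -- Insert `Sinv * S = 1` on the left; by `hS` the factor `S` passes the annihilation operator and
  -- cancels against the `Sinv` on its right.
  calc ann 𝓡 k b * Sinv y j = ∑ x, (∑ z, Sinv y z * S z x) * ann 𝓡 k b * Sinv x j := by
        simp only [e₂]
        simp
    _ = ∑ z, Sinv y z * ∑ x, S z x * ann 𝓡 k b * Sinv x j := by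
        simp only [Finset.sum_mul, Finset.mul_sum, mul_assoc]
        rw [Finset.sum_comm]
    _ = _ := by
        simp only [e₃, Finset.mul_sum, mul_smul_comm]

theorem sum_rotate_four {A ι₁ ι₂ ι₃ ι₄ : Type*} [AddCommMonoid A] [Fintype ι₁] [Fintype ι₂]
    [Fintype ι₃] [Fintype ι₄] (f : ι₁ → ι₂ → ι₃ → ι₄ → A) :
    ∑ a, ∑ b, ∑ c, ∑ d, f a b c d = ∑ c, ∑ d, ∑ b, ∑ a, f a b c d := by
  simp only [← Fintype.sum_prod_type']
  exact Fintype.sum_equiv ⟨fun a => (a.2.2.1, a.2.2.2, a.2.1, a.1),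
    fun a => (a.2.2.2, a.2.2.1, a.1, a.2.1), fun _ => rfl, fun _ => rfl⟩ _ _ fun _ => rfl

/-- `a_{1…m} T₀⁻¹ = T₀⁻¹ R₁₀ ⋯ R_{m0} a_{1…m}` -/
theorem annProd_mul_inverse {S : OpMatrix 𝓡} {k₀ : ℝ}
    (hS : ∀ (k : ℝ) (b y j : Fin N),
      ann 𝓡 k b * S y j = ∑ z, ∑ c, 𝓡.R k (-k₀) (b, z) (c, j) • (S y z * ann 𝓡 k c))
    (m : ℕ) (k : Fin m → ℝ) (β : Fin m → Fin N) (y j : Fin N) :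
    annProd 𝓡 k β * S y j = ∑ z, ∑ γ : Fin m → Fin N,
      tailProd 𝓡 m 0 k₀ k (Fin.cons z β) (Fin.cons j γ) • (S y z * annProd 𝓡 k γ) := by
  induction m with
  | zero =>
    have h : ∀ z (γ : Fin 0 → Fin N), tailProd 𝓡 0 0 k₀ k (Fin.cons z β) (Fin.cons j γ) =
        if z = j then 1 else 0 := fun z γ => by
      simp [tailProd, Matrix.one_apply, Fin.cons_inj, Subsingleton.elim β γ]
    simp [h, annProd]
  | succ m ih =>
    induction k using Fin.consCases with | _ q k =>
    induction β using Fin.consCases with | _ b β =>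
    -- The rightmost `m` operators cross first, by `ih`; the remaining one crosses by `hS` and
    -- supplies the leftmost factor of the tail product.
    simp only [sum_fin_cons (N := N) (n := m), tailProd_cons, annProd_cons, mul_assoc, ih,
      Finset.mul_sum, mul_smul_comm]
    simp only [← mul_assoc, hS, Finset.sum_mul, smul_mul_assoc, Finset.smul_sum, Finset.sum_smul,
      smul_smul]
    refine (sum_rotate_four _).trans ?_
    refine Finset.sum_congr rfl fun w _ => Finset.sum_congr rfl fun c _ =>
      Finset.sum_congr rfl fun γ _ => Finset.sum_congr rfl fun z _ => ?_
    rw [mul_comm]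

end Exchange

/-! ### Products of a term of `T` with the expanded inverse -/

section Cross

variable {N : ℕ} (𝓡 : RMatrix N)

/-- `X_{0,p+1…p+m} B₀ Y_{01…p} R'_{p+1,0} ⋯ R'_{p+m,0}` -/
def crossCoeff (B : Matrix (Fin N) (Fin N) ℂ) (k₀ : ℝ) (p m : ℕ)
    (X : (Fin m → ℝ) → Matrix (Fin (m + 1) → Fin N) (Fin (m + 1) → Fin N) ℂ)
    (Y : (Fin p → ℝ) → Matrix (Fin (p + 1) → Fin N) (Fin (p + 1) → Fin N) ℂ)
    (k : Fin (p + m) → ℝ) :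
    Matrix (Fin (p + m + 1) → Fin N) (Fin (p + m + 1) → Fin N) ℂ :=
  place (outerSites p m) (X fun s => k (Fin.natAdd p s)) * oneSite 0 B *
    place (innerSites p m) (Y fun s => k (Fin.castAdd m s)) * tailProd 𝓡 (p + m) p k₀ k

/-- The matrix elements of `X_{01…m} B₀ ⊗ R'_{10} ⋯ R'_{m0}`, the space `0` being cut between the two
factors. -/
def cutCoeff (B : Matrix (Fin N) (Fin N) ℂ) (k₀ : ℝ) (m : ℕ)
    (X : (Fin m → ℝ) → Matrix (Fin (m + 1) → Fin N) (Fin (m + 1) → Fin N) ℂ)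
    (i j : Fin N) (k : Fin m → ℝ) (α γ : Fin m → Fin N) (y z : Fin N) : ℂ :=
  ∑ x, ∑ β : Fin m → Fin N, X k (Fin.cons i α) (Fin.cons x β) * B x y *
    tailProd 𝓡 m 0 k₀ k (Fin.cons z β) (Fin.cons j γ)

variable (B : Matrix (Fin N) (Fin N) ℂ) (k₀ : ℝ) (p m : ℕ)
  (X : (Fin m → ℝ) → Matrix (Fin (m + 1) → Fin N) (Fin (m + 1) → Fin N) ℂ)
  (Y : (Fin p → ℝ) → Matrix (Fin (p + 1) → Fin N) (Fin (p + 1) → Fin N) ℂ) (i j : Fin N)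

/-- The two blocks communicate only through the space `0`: `y` and `z` are its indices on the two
sides of `Y`, and the rest is collected in `cutCoeff`. -/
theorem crossCoeff_apply (k' : Fin p → ℝ) (k : Fin m → ℝ) (α' β' : Fin p → Fin N)
    (α γ : Fin m → Fin N) :
    crossCoeff 𝓡 B k₀ p m X Y (Fin.append k' k) (Fin.cons i (Fin.append α' α))
        (Fin.cons j (Fin.append β' γ)) =
      ∑ y, ∑ z, cutCoeff 𝓡 B k₀ m X i j k α γ y z * Y k' (Fin.cons y α') (Fin.cons z β') := by
  have h₁ : (fun s => Fin.append k' k (Fin.natAdd p s)) = k := funext fun s => by simp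
  have h₂ : (fun s => Fin.append k' k (Fin.castAdd m s)) = k' := funext fun s => by simp
  simp only [crossCoeff, tailProd_add, h₁, h₂, mul_assoc, outer_mul_apply, inner_mul_apply,
    oneSite_zero_mul_apply, place_outer_apply, cutCoeff, mul_ite, mul_zero,
    Finset.sum_ite_eq', Finset.mem_univ, if_true, Finset.mul_sum, Finset.sum_mul]
  simp only [← Fintype.sum_prod_type']
  exact Fintype.sum_equiv ⟨fun a => (a.2.2.1, a.2.2.2, a.1, a.2.1),
    fun a => (a.2.2.1, a.2.2.2, a.1, a.2.1), fun _ => rfl, fun _ => rfl⟩ _ _ fun _ => by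
      simp only [Equiv.coe_fn_mk]; ring

theorem sum_fin_append {A : Type*} [AddCommMonoid A] (f : (Fin (p + m) → Fin N) → A) :
    ∑ α, f α = ∑ α' : Fin p → Fin N, ∑ α : Fin m → Fin N, f (Fin.append α' α) := by
  rw [← (Fin.appendEquiv p m).sum_comp, Fintype.sum_prod_type]
  rfl

/-- The normal ordered operator of `Y` sits intact between the outer `a†` and the outer `a`, so only
concatenation of indices is involved, no exchange relation. -/
theorem normalOrdered_crossCoeff (v : Fock 𝓡) :
    normalOrdered 𝓡 (p + m) (crossCoeff 𝓡 B k₀ p m X Y) i j v =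
      createProd 𝓡 m fun k α => ∑ γ, ∑ y, ∑ z, cutCoeff 𝓡 B k₀ m X i j k α γ y z •
        normalOrdered 𝓡 p Y y z (annProd 𝓡 k γ v) := by
  rw [normalOrdered, ← createProd_createProd]
  congr 1
  funext k α
  simp only [normalOrdered, ← createProd_smul, ← createProd_sum]
  congr 1
  funext k' α'
  simp only [sum_fin_append, crossCoeff_apply, annProd_append, Module.End.mul_apply,
    Finset.sum_smul, Finset.smul_sum, smul_smul]
  rw [Finset.sum_comm]
  refine Finset.sum_congr rfl fun γ _ => ?_
  rw [Finset.sum_comm]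
  refine Finset.sum_congr rfl fun y _ => ?_
  rw [Finset.sum_comm]

/-- The contribution of the identity term of `T⁻¹`, which glues the cut space `0` by setting `z =
y`. -/
theorem normalOrdered_mul_tailProd (v : Fock 𝓡) :
    normalOrdered 𝓡 m (fun k => X k * oneSite 0 B * tailProd 𝓡 m 0 k₀ k) i j v =
      createProd 𝓡 m fun k α => ∑ γ, ∑ y, cutCoeff 𝓡 B k₀ m X i j k α γ y y •
        annProd 𝓡 k γ v := by
  rw [normalOrdered]
  congr 1
  funext k α
  refine Finset.sum_congr rfl fun γ _ => ?_
  rw [← Finset.sum_smul, mul_assoc, Matrix.mul_apply, sum_fin_cons]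
  congr 1
  simp only [oneSite_zero_mul_apply, cutCoeff, Finset.mul_sum, mul_assoc]
  simp only [← Fintype.sum_prod_type']
  exact Fintype.sum_equiv ⟨fun a => (a.2.2, a.1, a.2.1),
    fun a => (a.2.1, a.2.2, a.1), fun _ => rfl, fun _ => rfl⟩ _ _ fun _ => rfl

theorem normalOrdered_oneSite_mul (v : Fock 𝓡) :
    normalOrdered 𝓡 p (fun k => oneSite 0 B * Y k) i j v =
      ∑ y, B i y • normalOrdered 𝓡 p Y y j v := by
  simp only [normalOrdered, ← createProd_smul, ← createProd_sum, oneSite_zero_mul_apply,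
    Finset.sum_smul, Finset.smul_sum, smul_smul]
  congr 1
  funext k α
  rw [Finset.sum_comm]

/-- The annihilation operators of a normal ordered operator moved through `S = T₀⁻¹`. -/
theorem normalOrdered_inverse {S : OpMatrix 𝓡}
    (hS : ∀ (k : ℝ) (b y j : Fin N),
      ann 𝓡 k b * S y j = ∑ z, ∑ c, 𝓡.R k (-k₀) (b, z) (c, j) • (S y z * ann 𝓡 k c))
    (v : Fock 𝓡) :
    ∑ y, ∑ x, B x y • normalOrdered 𝓡 m X i x (S y j v) =
      createProd 𝓡 m fun k α => ∑ γ, ∑ y, ∑ z, cutCoeff 𝓡 B k₀ m X i j k α γ y z •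
        S y z (annProd 𝓡 k γ v) := by
  simp only [normalOrdered, ← createProd_smul, ← createProd_sum]
  congr 1
  funext k α
  have h : ∀ β y, annProd 𝓡 k β (S y j v) = ∑ z, ∑ γ : Fin m → Fin N,
      tailProd 𝓡 m 0 k₀ k (Fin.cons z β) (Fin.cons j γ) • S y z (annProd 𝓡 k γ v) := fun β y => by
    have := congrArg (fun O : Module.End ℂ (Fock 𝓡) => O v)
      (annProd_mul_inverse 𝓡 hS m k β y j)
    simpa [LinearMap.sum_apply] using this
  simp only [h, cutCoeff, Finset.sum_smul, Finset.smul_sum, smul_smul]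
  simp only [← Fintype.sum_prod_type']
  exact Fintype.sum_equiv ⟨fun a => (a.2.2.2.2, a.1, a.2.2.2.1, a.2.1, a.2.2.1),
    fun a => (a.2.1, a.2.2.2.1, a.2.2.2.2, a.2.2.1, a.1), fun _ => rfl, fun _ => rfl⟩ _ _
    fun _ => by
      simp only [Equiv.coe_fn_mk]
      congr 1
      ring

/-- The normal ordered products `T⁽ᵐ⁾ B T⁻¹`, with `T⁻¹` expanded. -/
theorem normalOrdered_inverse_apply {S : OpMatrix 𝓡}
    (hS : ∀ (k : ℝ) (b y j : Fin N),
      ann 𝓡 k b * S y j = ∑ z, ∑ c, 𝓡.R k (-k₀) (b, z) (c, j) • (S y z * ann 𝓡 k c))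
    {Z : Coeff N} (hZ : HasExpansion 𝓡 S 1 Z) (v : Fock 𝓡) (l : List (ℝ × Fin N)) (L : ℕ)
    (hL : l.length ≤ L) :
    ∑ y, ∑ x, B x y * (normalOrdered 𝓡 m X i x (S y j v)).1 l =
      (normalOrdered 𝓡 m (fun k => X k * oneSite 0 B * tailProd 𝓡 m 0 k₀ k) i j v).1 l +
        ∑ n ∈ Finset.range L, (-1) ^ (n + 1) / (n.factorial : ℂ) *
          (normalOrdered 𝓡 (n + 1 + m) (crossCoeff 𝓡 B k₀ (n + 1) m X (Z (n + 1))) i j v).1 l := by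
  have h' : ∀ (W : Fock 𝓡), W = createProd 𝓡 m (fun k α => ∑ γ, ∑ y, ∑ z,
        cutCoeff 𝓡 B k₀ m X i j k α γ y z • ((1 : Matrix (Fin N) (Fin N) ℂ) y z •
          annProd 𝓡 k γ v + ∑ n ∈ Finset.range L, ((-1) ^ (n + 1) / (n.factorial : ℂ)) •
            normalOrdered 𝓡 (n + 1) (Z (n + 1)) y z (annProd 𝓡 k γ v))) → W.1 l =
      (normalOrdered 𝓡 m (fun k => X k * oneSite 0 B * tailProd 𝓡 m 0 k₀ k) i j v).1 l +
        ∑ n ∈ Finset.range L, (-1) ^ (n + 1) / (n.factorial : ℂ) *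
          (normalOrdered 𝓡 (n + 1 + m) (crossCoeff 𝓡 B k₀ (n + 1) m X (Z (n + 1))) i j v).1 l := by
    rintro W rfl
    have : createProd 𝓡 m (fun k α => ∑ γ, ∑ y, ∑ z,
        cutCoeff 𝓡 B k₀ m X i j k α γ y z • ((1 : Matrix (Fin N) (Fin N) ℂ) y z •
          annProd 𝓡 k γ v + ∑ n ∈ Finset.range L, ((-1) ^ (n + 1) / (n.factorial : ℂ)) •
            normalOrdered 𝓡 (n + 1) (Z (n + 1)) y z (annProd 𝓡 k γ v))) =
        normalOrdered 𝓡 m (fun k => X k * oneSite 0 B * tailProd 𝓡 m 0 k₀ k) i j v +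
        ∑ n ∈ Finset.range L, ((-1) ^ (n + 1) / (n.factorial : ℂ)) •
          normalOrdered 𝓡 (n + 1 + m) (crossCoeff 𝓡 B k₀ (n + 1) m X (Z (n + 1))) i j v := by
      simp only [normalOrdered_crossCoeff, normalOrdered_mul_tailProd, ← createProd_smul,
        ← createProd_sum, ← createProd_add]
      congr 1
      funext k α
      simp only [smul_add, Finset.sum_add_distrib, Finset.smul_sum]
      congr 1
      · simp [Matrix.one_apply, ite_smul]
      · rw [Finset.sum_comm' (t' := Finset.univ) (s' := fun _ => Finset.range L) (by simp)]
        refine Finset.sum_congr rfl fun γ _ => ?_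
        rw [Finset.sum_comm' (t' := Finset.univ) (s' := fun _ => Finset.range L) (by simp)]
        refine Finset.sum_congr rfl fun y _ => ?_
        rw [Finset.sum_comm]
        refine Finset.sum_congr rfl fun z _ => Finset.sum_congr rfl fun n _ => ?_
        rw [smul_comm]
    rw [this]
    simp [Finset.sum_apply]
  -- Both sides become creation products, the right one with a truncated expansion under the
  -- integral, so integrands can be compared.
  rw [← h' _ rfl]
  have e : ∀ (f : Fin N → Fin N → Fock 𝓡), (∑ y, ∑ x, B x y • f x y).1 l =
      ∑ y, ∑ x, B x y * (f x y).1 l := fun f => by simp [Finset.sum_apply]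
  rw [← e, normalOrdered_inverse 𝓡 B k₀ m X i j hS v]
  refine createProd_apply_congr 𝓡 m _ _ l fun k α l' hl => ?_
  have e' : ∀ f : (Fin m → Fin N) → Fin N → Fin N → Fock 𝓡,
      (∑ γ, ∑ y, ∑ z, cutCoeff 𝓡 B k₀ m X i j k α γ y z • f γ y z).1 l' =
      ∑ γ, ∑ y, ∑ z, cutCoeff 𝓡 B k₀ m X i j k α γ y z * (f γ y z).1 l' := fun f => by
    simp [Finset.sum_apply]
  rw [e', e']
  refine Finset.sum_congr rfl fun γ _ => Finset.sum_congr rfl fun y _ =>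
    Finset.sum_congr rfl fun z _ => ?_
  -- Here `l'.length + m = l.length ≤ L`, so the cutoff `L` is valid for `l'`.
  rw [(hasExpansion_iff 𝓡 _ _ _).1 hZ y z _ l' L (by omega)]
  simp [Finset.sum_apply]

end Cross

end ZF

namespace ZF

/-! ### Combinatorial weights and the expansion of the reflection operator -/

section Reflection

variable {N : ℕ} (𝓡 : RMatrix N)

/-- The signs and factorials of the expansions multiply to those of the reflection coefficients. -/
theorem expansion_factor_mul {n a : ℕ} (h : a < n) :
    (-1) ^ (n + 1) / (n.factorial : ℂ) * (((n + 1 : ℕ) : ℂ) - 1) * ((n - 1).choose a : ℂ) =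
      (-1) ^ (a + 1) / (a.factorial : ℂ) *
        ((-1) ^ (n - 1 - a + 1) / ((n - 1 - a).factorial : ℂ)) := by
  -- The orders of the two factors are `a + 1` and `b + 1`, the total order is `n + 1`.
  obtain ⟨b, rfl⟩ : ∃ b, n = a + b + 1 := ⟨n - 1 - a, by omega⟩
  have h₁ : a + b + 1 - 1 = a + b := by omega
  have h₂ : a + b - a = b := by omega
  have h₃ : ((a + b).choose a : ℂ) * (a.factorial : ℂ) * (b.factorial : ℂ) =
      ((a + b).factorial : ℂ) := by
    rw [← h₂]
    have := Nat.choose_mul_factorial_mul_factorial (Nat.le_add_right a b)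
    rw [h₂] at this ⊢
    exact_mod_cast this
  have ha : (a.factorial : ℂ) ≠ 0 := by exact_mod_cast a.factorial_ne_zero
  have hb : (b.factorial : ℂ) ≠ 0 := by exact_mod_cast b.factorial_ne_zero
  have hc : ((a + b).choose a : ℂ) ≠ 0 := by
    exact_mod_cast (Nat.choose_pos (Nat.le_add_right a b)).ne'
  have hn : ((a : ℂ) + b + 1) ≠ 0 := by exact_mod_cast (a + b).succ_ne_zero
  rw [h₁, h₂, Nat.factorial_succ]
  push_cast
  rw [← h₃]
  field_simp
  ring

/-- A Cauchy product of two truncated series, with terms of large degree vanishing. -/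
theorem sum_range_mul_range {A : Type*} [AddCommMonoid A] (f : ℕ → ℕ → A) (L : ℕ)
    (hf : ∀ a b, L < a + b + 2 → f a b = 0) :
    ∑ n ∈ Finset.range L, ∑ a ∈ Finset.range n, f a (n - 1 - a) =
      ∑ a ∈ Finset.range L, ∑ b ∈ Finset.range L, f a b := by
  obtain _ | M := L
  · simp
  -- The term `n = 0` is empty; the shift turns the rest into sums over the diagonals `a + b = n`.
  rw [Finset.sum_range_succ']
  simp only [Finset.range_zero, Finset.sum_empty, add_zero, Nat.add_sub_cancel]
  rw [Finset.sum_range_diag_flip M f, Finset.sum_range_succ _ M,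
    Finset.sum_eq_zero (s := Finset.range (M + 1)) (f := f M) fun b _ => hf _ _ (by omega), add_zero]
  refine Finset.sum_congr rfl fun a _ => ?_
  refine Finset.sum_subset (Finset.range_subset_range.2 (by omega)) fun b _ hb => hf _ _ ?_
  rw [Finset.mem_range] at hb
  omega

variable (B : ℝ → Matrix (Fin N) (Fin N) ℂ)
  (t tdag : (n : ℕ) → ℝ → (Fin n → ℝ) → Matrix (Fin (n + 1) → Fin N) (Fin (n + 1) → Fin N) ℂ)
  (k₀ : ℝ) (i j : Fin N) (v : Fock 𝓡)

/-- A free `n` with the equation `h` absorbs the dependent types: after substitution `n - p` is gone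
and the two placements agree definitionally. -/
theorem normalOrdered_reflectionCoeff_summand {n p q : ℕ} (h : p + q = n) :
    normalOrdered 𝓡 n (fun k =>
        place (Fin.cons 0 fun s : Fin q => Fin.succ ⟨p + s, by omega⟩)
            (t q k₀ fun s : Fin q => k ⟨p + s, by omega⟩) *
          oneSite 0 (B k₀) *
          place (Fin.castLE (by omega : p + 1 ≤ n + 1))
            (tdag p (-k₀) fun s : Fin p => k (Fin.castLE (by omega) s)) *
          tailProd 𝓡 n p k₀ k) i j v =
      normalOrdered 𝓡 (p + q) (crossCoeff 𝓡 (B k₀) k₀ p q (t q k₀) (tdag p (-k₀))) i j v := by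
  subst h
  have h : innerSites p q = Fin.castLE (by omega : p + 1 ≤ p + q + 1) := by
    funext r
    refine Fin.cases rfl (fun s => rfl) r
  unfold crossCoeff
  rw [h]
  rfl

theorem normalOrdered_reflectionCoeff (n : ℕ) :
    normalOrdered 𝓡 (n + 1) (reflectionCoeff 𝓡 B t tdag k₀ (n + 1)) i j v =
      normalOrdered 𝓡 (n + 1) (fun k => t (n + 1) k₀ k * oneSite 0 (B k₀) *
        tailProd 𝓡 (n + 1) 0 k₀ k) i j v +
      normalOrdered 𝓡 (n + 1) (fun k => oneSite 0 (B k₀) * tdag (n + 1) (-k₀) k) i j v +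
      (((n + 1 : ℕ) : ℂ) - 1) • ∑ a ∈ Finset.range n, ((n - 1).choose a : ℂ) •
        normalOrdered 𝓡 (a + 1 + (n - 1 - a + 1)) (crossCoeff 𝓡 (B k₀) k₀ (a + 1) (n - 1 - a + 1)
          (t (n - 1 - a + 1) k₀) (tdag (a + 1) (-k₀))) i j v := by
  unfold reflectionCoeff
  rw [normalOrdered_add, normalOrdered_add, normalOrdered_smul, normalOrdered_sum]
  congr 2
  simp only [normalOrdered_smul]
  have h : ∀ p : Fin (n + 1), _ := fun p =>
    normalOrdered_reflectionCoeff_summand 𝓡 B t tdag k₀ i j v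
      (Nat.add_sub_cancel' p.2.le : (p : ℕ) + (n + 1 - p) = n + 1)
  rw [Finset.sum_congr rfl fun p _ => congrArg _ (h p), Finset.sum_filter, Fin.sum_univ_succ,
    Finset.sum_range]
  simp only [Fin.val_zero, lt_irrefl, if_false, zero_add, Fin.val_succ, Nat.succ_pos, if_true,
    Nat.add_sub_cancel]
  refine Finset.sum_congr rfl fun a _ => ?_
  -- With `p = a + 1`; this needs `a < n`, and for `n = 0` the sum is empty.
  have : n + 1 - (a + 1 : ℕ) = n - 1 - a + 1 := by omega
  rw [this]
  rfl

/-- The expansion of `T B S`, for `S = T(-k₀)⁻¹`. -/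
theorem hasExpansion_reflection {O S : OpMatrix 𝓡}
    (hO : HasExpansion 𝓡 O 1 fun n => t n k₀) (hS : HasExpansion 𝓡 S 1 fun n => tdag n (-k₀))
    (ex : ∀ (k : ℝ) (b y j : Fin N),
      ann 𝓡 k b * S y j = ∑ z, ∑ c, 𝓡.R k (-k₀) (b, z) (c, j) • (S y z * ann 𝓡 k c)) :
    HasExpansion 𝓡 (O * scalarOp 𝓡 (B k₀) * S) (B k₀) (reflectionCoeff 𝓡 B t tdag k₀) := by
  rw [hasExpansion_iff] at hO ⊢
  have hS' := (hasExpansion_iff 𝓡 _ _ _).1 hS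
  intro i j v l L hL
  have e : ((O * scalarOp 𝓡 (B k₀) * S) i j v).1 l =
      ∑ y, ∑ x, B k₀ x y * (O i x (S y j v)).1 l := by
    simp [Matrix.mul_apply, scalarOp, LinearMap.sum_apply, Finset.sum_apply,
      Module.algebraMap_end_apply]
  -- Only `O` is expanded here; `S` stays whole until the annihilation operators have passed it.
  have e₁ : ((O * scalarOp 𝓡 (B k₀) * S) i j v).1 l = ∑ y, B k₀ i y * (S y j v).1 l +
      ∑ n ∈ Finset.range L, (-1) ^ (n + 1) / (n.factorial : ℂ) * ∑ y, ∑ x, B k₀ x y *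
        (normalOrdered 𝓡 (n + 1) (t (n + 1) k₀) i x (S y j v)).1 l := by
    rw [e]
    simp only [fun x y => hO i x (S y j v) l L hL, mul_add, Finset.sum_add_distrib]
    congr 1
    · simp [Matrix.one_apply]
    · simp only [Finset.mul_sum]
      refine (Finset.sum_congr rfl fun y _ => Finset.sum_comm).trans (Finset.sum_comm.trans ?_)
      refine Finset.sum_congr rfl fun n _ => Finset.sum_congr rfl fun y _ =>
        Finset.sum_congr rfl fun x _ => ?_
      ring
  have e₂ : ∑ y, B k₀ i y * (S y j v).1 l = B k₀ i j * v.1 l +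
      ∑ n ∈ Finset.range L, (-1) ^ (n + 1) / (n.factorial : ℂ) *
        (normalOrdered 𝓡 (n + 1) (fun k => oneSite 0 (B k₀) * tdag (n + 1) (-k₀) k) i j v).1 l := by
    have : ∀ n, (normalOrdered 𝓡 n (fun k => oneSite 0 (B k₀) * tdag n (-k₀) k) i j v).1 l =
        ∑ y, B k₀ i y * (normalOrdered 𝓡 n (tdag n (-k₀)) y j v).1 l := fun n => by
      rw [normalOrdered_oneSite_mul]
      simp [Finset.sum_apply]
    simp only [fun y => hS' y j v l L hL, mul_add, Finset.sum_add_distrib, this]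
    congr 1
    · simp [Matrix.one_apply]
    · simp only [Finset.mul_sum]
      rw [Finset.sum_comm]
      simp only [mul_left_comm]
  -- The pair `(a, b)` has total order `a + b + 2`, hence vanishes on `l` once this exceeds `L`.
  have e₃ := sum_range_mul_range (fun a b => (-1) ^ (a + 1) / (a.factorial : ℂ) *
    ((-1) ^ (b + 1) / (b.factorial : ℂ)) * (normalOrdered 𝓡 (a + 1 + (b + 1))
      (crossCoeff 𝓡 (B k₀) k₀ (a + 1) (b + 1) (t (b + 1) k₀) (tdag (a + 1) (-k₀))) i j v).1 l) L
    fun a b h => by rw [normalOrdered_apply_eq_zero 𝓡 _ _ _ _ _ _ (by omega), mul_zero]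
  rw [Finset.sum_comm] at e₃
  have e₄ : ∀ (n : ℕ) (P Q : Fock 𝓡) (c : ℂ) (V : ℕ → Fock 𝓡),
      (P + Q + c • ∑ a ∈ Finset.range n, ((n - 1).choose a : ℂ) • V a).1 l =
        P.1 l + Q.1 l + c * ∑ a ∈ Finset.range n, ((n - 1).choose a : ℂ) * (V a).1 l :=
    fun n P Q c V => by simp [Finset.sum_apply]
  rw [e₁, e₂]
  simp only [fun n => normalOrdered_inverse_apply 𝓡 (B k₀) k₀ n (t n k₀) i j ex hS v l L hL,
    normalOrdered_reflectionCoeff, e₄, mul_add, Finset.sum_add_distrib]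
  -- `x` is the `B₀` term, `q` the pure `T†` terms, `r` the pure `T` terms; only the cross terms
  -- `s`, `s'` remain to be matched.
  have e₅ : ∀ (x q r s s' : ℂ), s = s' → x + q + (r + s) = x + (r + q + s') := by
    rintro x q r s _ rfl
    ring
  refine e₅ _ _ _ _ _ (Eq.trans ?_ (e₃.symm.trans ?_))
  · refine Finset.sum_congr rfl fun b _ => ?_
    rw [Finset.mul_sum]
    refine Finset.sum_congr rfl fun a _ => ?_
    ring
  · refine Finset.sum_congr rfl fun n _ => ?_
    rw [Finset.mul_sum, Finset.mul_sum]
    refine Finset.sum_congr rfl fun a ha => ?_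
    rw [← expansion_factor_mul (Finset.mem_range.1 ha)]
    simp only [mul_assoc]

end Reflection

end ZF

theorem mainTheorem4 {N : ℕ} (𝓡 : ZF.RMatrix N)
    (B : ℝ → Matrix (Fin N) (Fin N) ℂ) (hB : ZF.IsReflectionMatrix 𝓡 B)
    (T Tinv : ℝ → ZF.OpMatrix 𝓡)
    (t tdag : (n : ℕ) → ℝ → (Fin n → ℝ) →
      Matrix (Fin (n + 1) → Fin N) (Fin (n + 1) → Fin N) ℂ)
    (hT : ZF.IsWellBred 𝓡 T t)
    (hinv : ∀ k : ℝ, T k * Tinv k = 1 ∧ Tinv k * T k = 1)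
    (htdag : ∀ k : ℝ, ZF.HasExpansion 𝓡 (Tinv k) 1 fun n => tdag n k) :
    ∀ k₀ : ℝ, ZF.HasExpansion 𝓡 (ZF.reflectionOp 𝓡 B T Tinv k₀) (B k₀)
      (ZF.reflectionCoeff 𝓡 B t tdag k₀) := by
  intro k₀
  -- The inverse is taken at `-k₀`, which is why the exchange produces `R(k_s, -k₀)`.
  exact ZF.hasExpansion_reflection 𝓡 B t tdag k₀ (hT.expansion k₀) (htdag (-k₀))
    (ZF.ann_mul_inverse 𝓡 (hinv (-k₀)).1 (hinv (-k₀)).2 fun k => hT.mul_ann (-k₀) k)
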